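/- Let $\lambda>0$ and $N>2$. Let $\mathcal V$ be a stationary Poisson point process of intensity $\lambda$ in $\mathbb R^2$. To each $u\in\mathcal V$ assign, independently of the other points and of $\mathcal V$, a direction $d_u\in\{(0,1),(1,0)\}$, each with probability $1/2$. Put $\Lambda_N=[0,N]^2$ and $\mathcal V_N=\mathcal V\cap\Lambda_N$. At time $0$ two rays start from every $u\in\mathcal V_N$, in the directions $d_u$ and $-d_u$. Each ray grows with speed $1$ until its tip reaches another ray; at that moment it stops and remains unchanged thereafter. Let $G_{\mathcal V_N}(t)$ be the union of the (closed) rays at time $t$. Consider the planar graph drawn by $G_{\mathcal V_N}(N)\cap\Lambda_N$ together with the boundary $\partial\Lambda_N$. Its vertices are the four corners of $\Lambda_N$ and the T-junctions of this drawing (points from which exactly three axis-parallel arms emanate), including those on $\partial\Lambda_N$. Its edges are the drawn segments that join two distinct vertices and contain no other vertex. Then, almost surely, $\mathcal V_N$ is finite, the growth rule determines the process $G_{\mathcal V_N}$ uniquely, and this planar graph has exactly $$3|\mathcal V_N|+4$$ edges. -/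

import Mathlib

open MeasureTheory ProbabilityTheory Set
open scoped ENNReal NNReal

namespace RectGilbert

/-! ## The marked Poisson process -/

/-- The plane. The metric is irrelevant below: rays are parallel to the axes, so that the speed of
growth and the Lebesgue measure are the Euclidean ones. -/
abbrev Plane : Type := ℝ × ℝ

/-- The number of points of the sequence `X` that lie in `B`. -/
noncomputable def count {Ω : Type*} (X : ℕ → Ω → Plane) (B : Set Plane) (ω : Ω) : ℕ∞ :=
  {i : ℕ | X i ω ∈ B}.encard

/-- `X 0, X 1, …` enumerates the points of a stationary Poisson process of intensity `lam` in the
plane (i.e. `∑ i, δ_(X i)` is a Poisson random measure with mean `lam` times Lebesgue measure; the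
points are then almost surely distinct and locally finite). -/
structure IsPoissonProcess {Ω : Type*} [MeasurableSpace Ω] (P : Measure Ω) (lam : ℝ)
    (X : ℕ → Ω → Plane) : Prop where
  measurable : ∀ i, Measurable (X i)
  /-- The number of points in `B` is Poisson distributed with mean `lam * |B|`. -/
  law : ∀ B : Set Plane, MeasurableSet B → volume B ≠ ∞ → ∀ k : ℕ,
    P {ω | count X B ω = k} = poissonMeasure (lam * (volume B).toReal).toNNReal {k}
  /-- The numbers of points in disjoint sets are independent. -/
  indep : ∀ (n : ℕ) (B : Fin n → Set Plane), (∀ j, MeasurableSet (B j)) →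
    Pairwise (fun j k => Disjoint (B j) (B k)) → iIndepFun (fun j => count X (B j)) P

/-- The points `X i` of a Poisson process carry independent directions `D i`, each of them vertical
or horizontal with probability `1/2`, and the directions are independent of the points. -/
structure IsMarkedPoissonProcess {Ω : Type*} [MeasurableSpace Ω] (P : Measure Ω) (lam : ℝ)
    (X D : ℕ → Ω → Plane) : Prop where
  poisson : IsPoissonProcess P lam X
  measurable_dir : ∀ i, Measurable (D i)
  vertical : ∀ i, P {ω | D i ω = (0, 1)} = 1 / 2
  horizontal : ∀ i, P {ω | D i ω = (1, 0)} = 1 / 2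
  indep_dir : iIndepFun D P
  indep : IndepFun (fun ω i => X i ω) (fun ω i => D i ω) P

/-- The square `[0, N]²`. -/
def square (N : ℝ) : Set Plane := Icc 0 N ×ˢ Icc 0 N

/-- The points of the process in `[0, N]²`. -/
def pointsIn {Ω : Type*} (X : ℕ → Ω → Plane) (N : ℝ) (ω : Ω) : Set Plane :=
  {u | ∃ i, X i ω = u} ∩ square N

/-- The points of the process in `[0, N]²`, each together with its direction. -/
def seedsIn {Ω : Type*} (X D : ℕ → Ω → Plane) (N : ℝ) (ω : Ω) : Set (Plane × Plane) :=
  {s | ∃ i, X i ω ∈ square N ∧ s = (X i ω, D i ω)}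

/-! ## Growth of the rays -/

/-- From each seed `(u, d)` two rays start at `u`, one with velocity `d`, one with velocity `-d`.
A ray is recorded as the pair (initial point, velocity). -/
def rays (S : Set (Plane × Plane)) : Set (Plane × Plane) :=
  {r | (r.1, r.2) ∈ S ∨ (r.1, -r.2) ∈ S}

/-- If the ray `r` stops growing at the time `T r` (never, if `T r = ∞`), this is the closed
segment that it occupies at time `t`. -/
def rayAt {S : Set (Plane × Plane)} (T : rays S → ℝ≥0∞) (r : rays S) (t : ℝ) : Set Plane :=
  {x | ∃ s : ℝ, 0 ≤ s ∧ s ≤ t ∧ ENNReal.ofReal s ≤ T r ∧ x = r.1.1 + s • r.1.2}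

/-- The growth rule: each ray grows with speed one until its tip reaches another ray, and then stops
for good. So `T r` is the first time `t > 0` at which the point at distance `t` along `r` lies on
what another ray occupies at time `t`; it is `∞` if there is no such time. -/
def IsGrowth {S : Set (Plane × Plane)} (T : rays S → ℝ≥0∞) : Prop :=
  ∀ r : rays S, T r = sInf (ENNReal.ofReal ''
    {t : ℝ | 0 < t ∧ ∃ r' : rays S, r' ≠ r ∧ r.1.1 + t • r.1.2 ∈ rayAt T r' t})

/-- The union of all rays at time `t`. -/
def config {S : Set (Plane × Plane)} (T : rays S → ℝ≥0∞) (t : ℝ) : Set Plane :=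
  ⋃ r : rays S, rayAt T r t

/-- The part in `[0, N]²` of the configuration at time `N`, together with the boundary of the
square. -/
def drawing {S : Set (Plane × Plane)} (T : rays S → ℝ≥0∞) (N : ℝ) : Set Plane :=
  (config T N ∩ square N) ∪ frontier (square N)

/-! ## The planar graph -/

/-- The axis directions in which the set `F` contains a short segment starting at `x`. -/
def arms (F : Set Plane) (x : Plane) : Set Plane :=
  {e | e ∈ ({(1, 0), (-1, 0), (0, 1), (0, -1)} : Set Plane) ∧
    ∃ ε : ℝ, 0 < ε ∧ ∀ s ∈ Icc 0 ε, x + s • e ∈ F}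

/-- `x` is a T-junction of `F`: exactly three of the four axis-parallel arms at `x` are drawn. -/
def IsTJunction (F : Set Plane) (x : Plane) : Prop := (arms F x).ncard = 3

/-- The vertices of the planar graph: the T-junctions and the four corners of the square. -/
def vertices (N : ℝ) (F : Set Plane) : Set Plane :=
  {x | IsTJunction F x} ∪ {(0, 0), (N, 0), (0, N), (N, N)}

/-- The planar graph of the drawing `F`: its edges are the segments drawn between two vertices that
have no vertex in between. -/
def planarGraph (N : ℝ) (F : Set Plane) : SimpleGraph Plane where
  Adj a b := a ≠ b ∧ a ∈ vertices N F ∧ b ∈ vertices N F ∧ segment ℝ a b ⊆ F ∧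
    Disjoint (openSegment ℝ a b) (vertices N F)
  symm := ⟨fun a b ⟨h, ha, hb, hs, hd⟩ =>
    ⟨h.symm, hb, ha, segment_symm ℝ a b ▸ hs, openSegment_symm ℝ a b ▸ hd⟩⟩
  loopless := ⟨fun _ h => h.1 rfl⟩

end RectGilbert

/-! Almost surely the seeds in the square are finitely many, lie in its interior, share no
coordinate, and no two differ by equal amounts in both coordinates
(`IsMarkedPoissonProcess.ae_isGeneric`). After that the argument is deterministic.

In general position a ray can only be stopped by a perpendicular ray that passes the crossing point
strictly earlier and has not itself been stopped before getting there. Whether this happens depends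
only on events at smaller times, so the stopping times exist and are unique by well-founded
recursion (`existsUnique_stopping`, `IsGeneric.existsUnique_growth`).

A ray that stops does so at a coordinate of another seed, hence within the square; every other ray
leaves through a side, before time `N`. The two rays of a seed thus form one segment, and each end
of it lies in the interior of a perpendicular segment or side. Two segments cannot cross, since the
ray that comes later to the common point is stopped there. This is `IsGeneric.isArrangement`.

For `n` segments the vertices are therefore the `2n` ends, of degree 3, and the four corners, of
degree 2, which gives `(6n + 8) / 2 = 3n + 4` edges. Formally the degree sum is replaced by its
half: each edge is recorded by its left or lower end. The two ends of a segment emit three arms in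
positive directions, and the four corners together emit four (`IsArrangement.encard_outgoing`,
`IsArrangement.encard_edgeSet_eq_outgoing`). -/

namespace RectGilbert

/-! ## Coordinates along and across an axis -/

/-- The coordinate along the axis `b` (`true` for the first axis). -/
def par (b : Bool) (p : Plane) : ℝ := if b then p.1 else p.2

/-- The unit vector of the axis `b`. -/
def axis (b : Bool) : Plane := if b then (1, 0) else (0, 1)

/-- The unit vectors of the axis `b`, indexed by their sign. -/
def dir (b σ : Bool) : Plane := if σ then axis b else -axis b

/-- The point with coordinate `x` along the axis `b` and `y` across it. -/
def point (b : Bool) (x y : ℝ) : Plane := if b then (x, y) else (y, x)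

/-- The sign of a direction as a number. -/
def sgn (σ : Bool) : ℝ := if σ then 1 else -1

@[simp] lemma par_point (b : Bool) (x y : ℝ) : par b (point b x y) = x := by
  cases b <;> rfl

@[simp] lemma par_not_point (b : Bool) (x y : ℝ) : par (!b) (point b x y) = y := by
  cases b <;> rfl

lemma eq_iff_par (b : Bool) {p q : Plane} :
    p = q ↔ par b p = par b q ∧ par (!b) p = par (!b) q := by
  cases b <;> simp [par, Prod.ext_iff, and_comm]

@[simp] lemma par_add (b : Bool) (p q : Plane) : par b (p + q) = par b p + par b q := by
  cases b <;> simp [par]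

@[simp] lemma par_smul (b : Bool) (s : ℝ) (p : Plane) : par b (s • p) = s * par b p := by
  cases b <;> simp [par]

@[simp] lemma par_neg (b : Bool) (p : Plane) : par b (-p) = -par b p := by
  cases b <;> simp [par]

@[simp] lemma par_axis (b : Bool) : par b (axis b) = 1 := by
  cases b <;> simp [par, axis]

@[simp] lemma par_not_axis (b : Bool) : par (!b) (axis b) = 0 := by
  cases b <;> simp [par, axis]

@[simp] lemma par_dir (b σ : Bool) : par b (dir b σ) = sgn σ := by
  cases σ <;> simp [dir, sgn]

@[simp] lemma par_not_dir (b σ : Bool) : par (!b) (dir b σ) = 0 := by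
  cases σ <;> simp [dir]

lemma dir_inj {b σ b' σ' : Bool} : dir b σ = dir b' σ' ↔ b = b' ∧ σ = σ' := by
  cases b <;> cases b' <;> cases σ <;> cases σ' <;> simp [dir, axis] <;> norm_num

lemma mem_directions {e : Plane} :
    e ∈ ({(1, 0), (-1, 0), (0, 1), (0, -1)} : Set Plane) ↔ ∃ b σ, e = dir b σ := by
  simp only [Bool.exists_bool, dir, axis]
  simp
  tauto

/-! ## Arrangements of segments in a square -/

/-- An axis-parallel segment: its axis, its coordinate across the axis and its extent. -/
structure Seg where
  o : Bool
  c : ℝ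
  lo : ℝ
  hi : ℝ

namespace Seg

def carrier (s : Seg) : Set Plane := {p | par (!s.o) p = s.c ∧ par s.o p ∈ Icc s.lo s.hi}

/-- The coordinate of the upper or lower end. -/
def bound (s : Seg) (σ : Bool) : ℝ := if σ then s.hi else s.lo

/-- The upper or lower end. -/
def endpt (s : Seg) (σ : Bool) : Plane := point s.o (s.bound σ) s.c

end Seg

/-- The sides of the square, indexed by their axis and their position. -/
def side (N : ℝ) (k : Bool × Bool) : Seg := ⟨k.1, if k.2 then N else 0, 0, N⟩

/-- The segments of a family together with the four sides of the square. -/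
def full (N : ℝ) {J : Type*} (g : J → Seg) : J ⊕ Bool × Bool → Seg := Sum.elim g (side N)

/-- The union of the segments of a family and of the four sides of the square. -/
def picture (N : ℝ) {J : Type*} (g : J → Seg) : Set Plane := ⋃ k, (full N g k).carrier

/-- The segments of the family end at interior points of segments across, and have no
other intersections. -/
structure IsArrangement (N : ℝ) {J : Type*} (g : J → Seg) : Prop where
  lt : ∀ j, (g j).lo < (g j).hi
  lo_nonneg : ∀ j, 0 ≤ (g j).lo
  hi_le : ∀ j, (g j).hi ≤ N
  c_mem : ∀ j, (g j).c ∈ Ioo 0 N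
  inj : ∀ i j, (g i).o = (g j).o → (g i).c = (g j).c → i = j
  ends : ∀ i σ, ∃ k, (full N g k).o = !(g i).o ∧ (full N g k).c = (g i).bound σ ∧
    (g i).c ∈ Ioo (full N g k).lo (full N g k).hi
  cross : ∀ i j, (g j).o = !(g i).o → (g j).c ∈ Icc (g i).lo (g i).hi →
    (g i).c ∈ Icc (g j).lo (g j).hi →
    (∃ σ, (g j).c = (g i).bound σ) ∨ ∃ σ, (g i).c = (g j).bound σ

namespace IsArrangement

variable {N : ℝ} {J : Type*} {g : J → Seg}

/-- Segments of the family lie strictly between the sides, so none is collinear with a side. A line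
thus carries at most one segment of the picture. -/
lemma full_inj (h : IsArrangement N g) (hN : 0 < N) {k l : J ⊕ Bool × Bool}
    (ho : (full N g k).o = (full N g l).o) (hc : (full N g k).c = (full N g l).c) : k = l := by
  rcases k with j | ⟨b, s⟩ <;> rcases l with j' | ⟨b', s'⟩
  · exact congrArg _ (h.inj j j' ho hc)
  · exfalso
    have := h.c_mem j
    simp only [full, Sum.elim_inl, Sum.elim_inr, side] at hc
    cases s' <;> simp_all
  · exfalso
    have := h.c_mem j'
    simp only [full, Sum.elim_inl, Sum.elim_inr, side] at hc
    cases s <;> simp_all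
  · simp only [full, Sum.elim_inr, side] at ho hc
    cases s <;> cases s' <;> simp_all

/-- Intersecting segments meet at an end of one of them. -/
lemma full_cross (h : IsArrangement N g) {k l : J ⊕ Bool × Bool}
    (ho : (full N g l).o = !(full N g k).o)
    (h1 : (full N g l).c ∈ Icc (full N g k).lo (full N g k).hi)
    (h2 : (full N g k).c ∈ Icc (full N g l).lo (full N g l).hi) :
    (∃ σ, (full N g l).c = (full N g k).bound σ) ∨
      ∃ σ, (full N g k).c = (full N g l).bound σ := by
  rcases k with j | ⟨b, s⟩ <;> rcases l with j' | ⟨b', s'⟩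
  · exact h.cross j j' ho h1 h2
  · left
    have h3 := h.lo_nonneg j
    have h4 := h.hi_le j
    refine ⟨s', ?_⟩
    simp only [full, Sum.elim_inl, Sum.elim_inr, side, mem_Icc] at h1 ⊢
    cases s' <;> simp [Seg.bound] at h1 ⊢ <;> linarith
  · right
    have h3 := h.lo_nonneg j'
    have h4 := h.hi_le j'
    refine ⟨s, ?_⟩
    simp only [full, Sum.elim_inl, Sum.elim_inr, side, mem_Icc] at h2 ⊢
    cases s <;> simp [Seg.bound] at h2 ⊢ <;> linarith
  · left
    refine ⟨s', ?_⟩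
    simp [full, side, Seg.bound]

/-- A direction is an arm at `p` if `p` lies on a segment of this direction, but not at its end. -/
lemma dir_mem_arms (h : IsArrangement N g) (hN : 0 < N) [Finite J] {p : Plane} {b σ : Bool} :
    dir b σ ∈ arms (picture N g) p ↔
      ∃ k, (full N g k).o = b ∧ p ∈ (full N g k).carrier ∧ par b p ≠ (full N g k).bound σ := by
  constructor
  · rintro ⟨-, ε, hε, hF⟩
    -- Pigeonhole: of the infinitely many points of a short arm two lie on one segment. That segment
    -- must run along `b`, because across it the coordinate is constant.
    have key : ∀ η, 0 < η → η ≤ ε → ∃ k, (full N g k).o = b ∧ (full N g k).c = par (!b) p ∧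
        ∃ s, 0 < s ∧ s ≤ η ∧ par b p + s * sgn σ ∈ Icc (full N g k).lo (full N g k).hi := by
      intro η h0 h1
      have : ∀ s : Ioc 0 η, ∃ k, p + (s : ℝ) • dir b σ ∈ (full N g k).carrier := fun s =>
        mem_iUnion.1 (hF s ⟨s.2.1.le, s.2.2.trans h1⟩)
      choose f hf using this
      have : Infinite (Ioc 0 η) := (Ioc_infinite h0).to_subtype
      obtain ⟨s, t, hst, he⟩ := Finite.exists_ne_map_eq_of_infinite f
      have hs := hf s
      have ht := hf t
      rw [← he] at ht
      have hob : (full N g (f s)).o = b := by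
        by_contra hne
        have hb : (!(full N g (f s)).o) = b := by
          revert hne; cases (full N g (f s)).o <;> cases b <;> simp
        have h3 := hs.1.trans ht.1.symm
        rw [hb] at h3
        apply hst
        ext
        cases σ <;> simpa [sgn] using h3
      refine ⟨f s, hob, ?_, s, s.2.1, s.2.2, ?_⟩
      · have := hs.1
        rw [hob] at this
        simpa using this.symm
      · have := hs.2
        rw [hob] at this
        simpa using this
    obtain ⟨k, hko, hkc, s, hs0, hsε, hs⟩ := key ε hε le_rfl
    -- The segment does not depend on `η`, as it is the only one on its line. Letting `η` tend to 0
    -- shows that it contains `p` itself.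
    have hall : ∀ η, 0 < η → η ≤ ε →
        ∃ s, 0 < s ∧ s ≤ η ∧ par b p + s * sgn σ ∈ Icc (full N g k).lo (full N g k).hi := by
      intro η h0 h1
      obtain ⟨l, hlo, hlc, hl⟩ := key η h0 h1
      rwa [h.full_inj hN (hlo.trans hko.symm) (hlc.trans hkc.symm)] at hl
    refine ⟨k, hko, ⟨by rw [hko, hkc], ?_⟩, ?_⟩
    · rw [hko]
      cases σ
      · simp only [sgn, mem_Icc] at hs hall
        simp at hs hall
        constructor
        · linarith
        · apply le_of_forall_pos_le_add
          intro η hη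
          obtain ⟨s, -, h2, -, h3⟩ := hall (min η ε) (lt_min hη hε) (min_le_right _ _)
          linarith [min_le_left η ε]
      · simp only [sgn, mem_Icc] at hs hall
        simp at hs hall
        constructor
        · apply le_of_forall_pos_le_add
          intro η hη
          obtain ⟨s, -, h2, h3, -⟩ := hall (min η ε) (lt_min hη hε) (min_le_right _ _)
          linarith [min_le_left η ε]
        · linarith
    · cases σ <;> simp [sgn, Seg.bound] at hs ⊢ <;> intro <;> linarith
  · rintro ⟨k, rfl, ⟨hc, hl, hh⟩, hne⟩
    refine ⟨mem_directions.2 ⟨_, _, rfl⟩, ?_⟩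
    cases σ
    · refine ⟨par (full N g k).o p - (full N g k).lo,
        sub_pos.2 (lt_of_le_of_ne hl (Ne.symm hne)), fun s hs => mem_iUnion.2 ⟨k, ?_, ?_⟩⟩
      · simpa using hc
      · have := hs.1
        have := hs.2
        simp only [par_add, par_smul, par_dir, sgn, mem_Icc]
        constructor <;> simp <;> linarith
    · refine ⟨(full N g k).hi - par (full N g k).o p,
        sub_pos.2 (lt_of_le_of_ne hh hne), fun s hs => mem_iUnion.2 ⟨k, ?_, ?_⟩⟩
      · simpa using hc
      · have := hs.1
        have := hs.2
        simp only [par_add, par_smul, par_dir, sgn, mem_Icc]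
        constructor <;> simp <;> linarith

end IsArrangement

/-! ### Vertices of an arrangement and their arms -/

/-- The ends of the segments of a family and the corners of the square. -/
def node (N : ℝ) {J : Type*} (g : J → Seg) : (J × Bool) ⊕ (Bool × Bool) → Plane :=
  Sum.elim (fun x => (g x.1).endpt x.2) fun s => (if s.1 then N else 0, if s.2 then N else 0)

lemma Seg.par_endpt (s : Seg) (σ : Bool) : par s.o (s.endpt σ) = s.bound σ := par_point ..

lemma Seg.par_not_endpt (s : Seg) (σ : Bool) : par (!s.o) (s.endpt σ) = s.c := par_not_point ..

lemma Seg.bound_mem (s : Seg) (h : s.lo ≤ s.hi) (σ : Bool) : s.bound σ ∈ Icc s.lo s.hi := by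
  cases σ <;> simp [Seg.bound, h]

lemma Seg.endpt_mem (s : Seg) (h : s.lo ≤ s.hi) (σ : Bool) : s.endpt σ ∈ s.carrier :=
  ⟨s.par_not_endpt σ, by rw [s.par_endpt]; exact s.bound_mem h σ⟩

lemma Seg.eq_endpt {s : Seg} {p : Plane} (hp : p ∈ s.carrier) {σ : Bool}
    (h : par s.o p = s.bound σ) : p = s.endpt σ :=
  (eq_iff_par s.o).2 ⟨by rw [h, s.par_endpt], by rw [hp.1, s.par_not_endpt]⟩

lemma Seg.bound_inj {s : Seg} (h : s.lo < s.hi) {σ τ : Bool} :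
    s.bound σ = s.bound τ ↔ σ = τ := by
  cases σ <;> cases τ <;> simp [Seg.bound, h.ne, h.ne']

/-- The directions in which a segment leaves the given node. -/
def HasArm {J : Type*} (g : J → Seg) : (J × Bool) ⊕ (Bool × Bool) → Bool → Bool → Prop
  | .inl (i, σ), b, τ => b ≠ (g i).o ∨ τ ≠ σ
  | .inr s, b, τ => τ ≠ if b then s.1 else s.2

instance {J : Type*} (g : J → Seg) (x b τ) : Decidable (HasArm g x b τ) := by
  rcases x with ⟨i, σ⟩ | s <;> simp only [HasArm] <;> infer_instance

namespace IsArrangement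

variable {N : ℝ} {J : Type*} {g : J → Seg}

/-- At an end of a segment only the outward arm is missing: the segment itself is the only one on
its line, while the segment it abuts on has the end in its interior and supplies both transverse
arms. At a corner just the two arms pointing out of the square are missing. -/
lemma arms_node (h : IsArrangement N g) (hN : 0 < N) [Finite J]
    (x : (J × Bool) ⊕ (Bool × Bool)) (b τ : Bool) :
    dir b τ ∈ arms (picture N g) (node N g x) ↔ HasArm g x b τ := by
  rw [h.dir_mem_arms hN]
  rcases x with ⟨i, σ⟩ | s
  · simp only [node, Sum.elim_inl, HasArm]
    constructor
    · rintro ⟨k, rfl, hk, hne⟩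
      by_contra! hc
      obtain ⟨ho, rfl⟩ := hc
      have : k = Sum.inl i := h.full_inj hN ho (by
        rw [← hk.1, ho]; exact (g i).par_not_endpt _)
      subst this
      exact hne ((g i).par_endpt _)
    · intro hb
      by_cases hbo : b = (g i).o
      · subst hbo
        have hτ : τ ≠ σ := by simpa using hb
        refine ⟨Sum.inl i, rfl, (g i).endpt_mem (h.lt i).le σ, ?_⟩
        rw [(g i).par_endpt]
        exact fun he => hτ ((Seg.bound_inj (h.lt i)).1 he).symm
      · obtain ⟨k, hko, hkc, hk⟩ := h.ends i σ
        have hb' : b = !(g i).o := by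
          revert hbo; cases b <;> cases (g i).o <;> simp
        have hpar : par b ((g i).endpt σ) = (g i).c := by rw [hb', (g i).par_not_endpt]
        refine ⟨k, hko.trans hb'.symm, ⟨?_, ?_⟩, ?_⟩
        · rw [hko, Bool.not_not, (g i).par_endpt, hkc]
        · rw [hko, (g i).par_not_endpt]; exact Ioo_subset_Icc_self hk
        · rw [hpar]
          cases τ
          · exact hk.1.ne'
          · exact hk.2.ne
  · simp only [node, Sum.elim_inr, HasArm]
    constructor
    · rintro ⟨k, rfl, hk, hne⟩ rfl
      have : k = Sum.inr ((full N g k).o, if (full N g k).o then s.2 else s.1) :=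
        h.full_inj hN rfl (by
          rw [← hk.1]
          cases (full N g k).o <;> simp [par, full, side])
      generalize (full N g k).o = b at *
      subst this
      apply hne
      cases b <;> simp [par, full, side, Seg.bound]
    · intro hτ
      refine ⟨Sum.inr (b, if b then s.2 else s.1), rfl, ⟨?_, ?_⟩, ?_⟩
      · cases b <;> simp [par, full, side]
      · rcases s with ⟨s1, s2⟩
        cases b <;> cases s1 <;> cases s2 <;> simp [par, full, side, hN.le]
      · rcases s with ⟨s1, s2⟩
        cases b <;> cases τ <;> cases s1 <;> cases s2 <;>
          simp [par, full, side, Seg.bound, hN.ne, hN.ne'] at hτ ⊢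

/-- The missing arms identify the node. A corner lacks one arm along each axis, an end a single arm,
which reveals the axis and the sign of the end; the transverse coordinate then determines the
segment. -/
lemma node_injective (h : IsArrangement N g) (hN : 0 < N) [Finite J] :
    Function.Injective (node N g) := by
  intro x y hxy
  have key : ∀ b τ, HasArm g x b τ ↔ HasArm g y b τ := fun b τ => by
    rw [← h.arms_node hN, hxy, h.arms_node hN]
  rcases x with ⟨i, σ⟩ | ⟨s1, s2⟩ <;> rcases y with ⟨j, τ⟩ | ⟨t1, t2⟩
  · have h1 := key (g i).o σ
    simp only [HasArm, ne_eq, not_true_eq_false, or_self, false_iff, not_or, not_not] at h1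
    obtain ⟨ho, rfl⟩ := h1
    have hc : (g i).c = (g j).c := by
      rw [← (g i).par_not_endpt σ, ← (g j).par_not_endpt σ, ho]
      exact congrArg _ hxy
    rw [h.inj i j ho hc]
  · have h1 := key true t1
    have h2 := key false t2
    simp [HasArm] at h1 h2
    simp_all
  · have h1 := key true s1
    have h2 := key false s2
    simp [HasArm] at h1 h2
    simp_all
  · have h1 := key true s1
    have h2 := key false s2
    simp [HasArm] at h1 h2
    simp_all

lemma endpt_mem_range_node (k : J ⊕ Bool × Bool) (σ : Bool) :
    (full N g k).endpt σ ∈ range (node N g) := by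
  rcases k with i | ⟨b, s⟩
  · exact ⟨Sum.inl (i, σ), rfl⟩
  · refine ⟨Sum.inr (if b then σ else s, if b then s else σ), ?_⟩
    cases b <;> simp [node, full, side, Seg.endpt, Seg.bound, point]

/-- Three arms cannot all lie along one axis, so two perpendicular segments meet at a T-junction,
and by `full_cross` it is an end of one of them. Conversely, `arms_node` leaves exactly three arms
at each end of a segment of the family. -/
lemma vertices_eq (h : IsArrangement N g) (hN : 0 < N) [Finite J] :
    vertices N (picture N g) = range (node N g) := by
  apply Subset.antisymm
  · rintro p (hp | hp)
    · have hsub : ∀ b, ∃ σ, dir b σ ∈ arms (picture N g) p := by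
        intro b
        by_contra! hb
        have : arms (picture N g) p ⊆ {dir (!b) true, dir (!b) false} := by
          intro e he
          obtain ⟨b', σ, rfl⟩ := mem_directions.1 he.1
          have hbb : b' = !b := by
            by_contra hne
            have : b' = b := by revert hne; cases b <;> cases b' <;> simp
            exact hb σ (this ▸ he)
          subst hbb
          cases σ <;> simp
        have h3 := ncard_le_ncard this
        rw [hp] at h3
        have h4 := ncard_insert_le (dir (!b) true) {dir (!b) false}
        rw [ncard_singleton] at h4
        omega
      obtain ⟨σ, h1⟩ := hsub true
      obtain ⟨τ, h2⟩ := hsub false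
      obtain ⟨k, hk, hkp, -⟩ := (h.dir_mem_arms hN).1 h1
      obtain ⟨l, hl, hlp, -⟩ := (h.dir_mem_arms hN).1 h2
      have e1 : (full N g l).c = par (full N g k).o p := by rw [← hlp.1, hl, hk]; rfl
      have e2 : (full N g k).c = par (full N g l).o p := by rw [← hkp.1, hl, hk]; rfl
      rcases h.full_cross (k := k) (l := l) (by rw [hk, hl]; rfl) (by rw [e1]; exact hkp.2)
        (by rw [e2]; exact hlp.2) with ⟨ρ, hρ⟩ | ⟨ρ, hρ⟩
      · rw [Seg.eq_endpt hkp (e1.symm.trans hρ)]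
        exact endpt_mem_range_node k ρ
      · rw [Seg.eq_endpt hlp (e2.symm.trans hρ)]
        exact endpt_mem_range_node l ρ
    · simp only [mem_insert_iff, mem_singleton_iff] at hp
      rcases hp with rfl | rfl | rfl | rfl
      · exact ⟨Sum.inr (false, false), by simp [node]⟩
      · exact ⟨Sum.inr (true, false), by simp [node]⟩
      · exact ⟨Sum.inr (false, true), by simp [node]⟩
      · exact ⟨Sum.inr (true, true), by simp [node]⟩
  · rintro _ ⟨⟨i, σ⟩ | ⟨s1, s2⟩, rfl⟩
    · left
      have : arms (picture N g) (node N g (Sum.inl (i, σ))) =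
          {dir (g i).o (!σ), dir (!(g i).o) true, dir (!(g i).o) false} := by
        ext e
        constructor
        · intro he
          obtain ⟨b, τ, rfl⟩ := mem_directions.1 he.1
          have := (h.arms_node hN _ _ _).1 he
          simp only [HasArm] at this
          simp only [mem_insert_iff, mem_singleton_iff, dir_inj]
          revert this
          cases b <;> cases (g i).o <;> cases τ <;> cases σ <;> simp
        · rintro (rfl | rfl | rfl) <;> rw [h.arms_node hN] <;> simp [HasArm]
      rw [mem_ofPred_eq, IsTJunction, this, ncard_eq_three]
      exact ⟨_, _, _, by simp [dir_inj], by simp [dir_inj], by simp [dir_inj], rfl⟩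
    · right
      cases s1 <;> cases s2 <;> simp [node]

/-- A vertex and a positive axis direction in which an edge leaves it. -/
def outgoing (N : ℝ) (F : Set Plane) : Set (Plane × Bool) :=
  {q | q.1 ∈ vertices N F ∧ axis q.2 ∈ arms F q.1}

/-- Each segment contributes the positive transverse arm at both ends and the positive arm along
itself at its lower end, in all 3; the corners contribute 2 + 1 + 1 + 0 = 4. -/
lemma encard_outgoing (h : IsArrangement N g) (hN : 0 < N) [Finite J] :
    (outgoing N (picture N g)).encard = 3 * (Nat.card J : ℕ∞) + 4 := by
  have := Fintype.ofFinite J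
  have hO : outgoing N (picture N g) =
      Prod.map (node N g) id '' {y | HasArm g y.1 y.2 true} := by
    ext ⟨p, b⟩
    simp only [outgoing, h.vertices_eq hN, mem_ofPred_eq, mem_image, Prod.exists, Prod.map_apply,
      id, Prod.mk.injEq]
    constructor
    · rintro ⟨⟨x, rfl⟩, hx⟩
      exact ⟨x, b, (h.arms_node hN x b true).1 hx, rfl, rfl⟩
    · rintro ⟨x, b, hx, rfl, rfl⟩
      exact ⟨⟨x, rfl⟩, (h.arms_node hN x b true).2 hx⟩
  rw [hO, ((h.node_injective hN).prodMap Function.injective_id).encard_image]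
  have hcard : (Finset.univ.filter fun y : ((J × Bool) ⊕ (Bool × Bool)) × Bool =>
      HasArm g y.1 y.2 true).card = 3 * Fintype.card J + 4 := by
    rw [Finset.card_filter, Fintype.sum_prod_type, Fintype.sum_sum_type, Fintype.sum_prod_type]
    have h1 : ∀ i : J, (∑ σ : Bool, ∑ b : Bool,
        if HasArm g (Sum.inl (i, σ)) b true then 1 else 0) = 3 := by
      intro i
      cases ho : (g i).o <;> simp [HasArm, ho] <;> decide
    simp only [h1]
    simp [Fintype.sum_prod_type, HasArm, mul_comm]
    decide
  rw [← Finset.coe_filter_univ, encard_coe_eq_coe_finsetCard, hcard, Nat.card_eq_fintype_card]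
  push_cast
  rfl

end IsArrangement

/-! ### Edges correspond to positive arms at vertices -/

lemma openSegment_add_smul (p e : Plane) {t : ℝ} (ht : 0 < t) :
    openSegment ℝ p (p + t • e) = (fun s : ℝ => p + s • e) '' Ioo 0 t := by
  rw [openSegment_eq_image']
  ext x
  simp only [mem_image, add_sub_cancel_left, smul_smul]
  constructor
  · rintro ⟨θ, h, rfl⟩
    exact ⟨θ * t, ⟨mul_pos h.1 ht, by nlinarith [h.1, h.2]⟩, rfl⟩
  · rintro ⟨s, h, rfl⟩
    exact ⟨s / t, ⟨div_pos h.1 ht, (div_lt_one ht).2 h.2⟩, by rw [div_mul_cancel₀ _ ht.ne']⟩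

lemma segment_add_smul (p e : Plane) {t : ℝ} (ht : 0 < t) :
    segment ℝ p (p + t • e) = (fun s : ℝ => p + s • e) '' Icc 0 t := by
  rw [segment_eq_image']
  ext x
  simp only [mem_image, add_sub_cancel_left, smul_smul]
  constructor
  · rintro ⟨θ, h, rfl⟩
    exact ⟨θ * t, ⟨mul_nonneg h.1 ht.le, by nlinarith [h.1, h.2]⟩, rfl⟩
  · rintro ⟨s, h, rfl⟩
    exact ⟨s / t, ⟨div_nonneg h.1 ht.le, (div_le_one ht).2 h.2⟩, by rw [div_mul_cancel₀ _ ht.ne']⟩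

lemma eq_add_smul_axis {a b : Plane} {c : Bool} (h : par (!c) a = par (!c) b) :
    b = a + (par c b - par c a) • axis c :=
  (eq_iff_par c).2 ⟨by simp, by simp [h]⟩

namespace IsArrangement

variable {N : ℝ} {J : Type*} {g : J → Seg}

/-- Drawn segments are parallel to an axis. -/
lemma exists_par_eq [Finite J] {a b : Plane} (hab : segment ℝ a b ⊆ picture N g) :
    ∃ c, par c a = par c b := by
  rw [segment_eq_image'] at hab
  have : ∀ θ : Icc (0 : ℝ) 1, ∃ k, a + (θ : ℝ) • (b - a) ∈ (full N g k).carrier := fun θ =>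
    mem_iUnion.1 (hab (mem_image_of_mem _ θ.2))
  choose f hf using this
  have : Infinite (Icc (0 : ℝ) 1) := (Icc_infinite zero_lt_one).to_subtype
  -- The transverse coordinate of the segment found is an affine function of the parameter with
  -- equal values at `s` and `t`, hence constant.
  obtain ⟨s, t, hst, he⟩ := Finite.exists_ne_map_eq_of_infinite f
  have hs := (hf s).1
  have ht := (hf t).1
  rw [← he] at ht
  refine ⟨!(full N g (f s)).o, ?_⟩
  have h1 := hs.trans ht.symm
  simp only [sub_eq_add_neg, par_add, par_smul, par_neg] at h1
  have h2 : ((s : ℝ) - t) * (par (!(full N g (f s)).o) b - par (!(full N g (f s)).o) a) = 0 := by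
    linarith
  rcases mul_eq_zero.1 h2 with h3 | h3
  · exact absurd (Subtype.ext (sub_eq_zero.1 h3)) hst
  · exact (sub_eq_zero.1 h3).symm

/-- Go along the segment carrying the arm to the first vertex. There is one, since the upper end of
the segment is a vertex and vertices are finitely many. -/
lemma exists_next (h : IsArrangement N g) (hN : 0 < N) [Finite J] {q : Plane × Bool}
    (hq : q ∈ outgoing N (picture N g)) :
    ∃ t : ℝ, 0 < t ∧ (planarGraph N (picture N g)).Adj q.1 (q.1 + t • axis q.2) := by
  obtain ⟨p, b⟩ := q
  obtain ⟨hp, harm⟩ := hq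
  obtain ⟨k, rfl, hk, hne⟩ := (h.dir_mem_arms hN (σ := true)).1 harm
  set s := full N g k with hs
  simp only at hp harm ⊢
  set A : Set ℝ := {t | 0 < t ∧ p + t • axis s.o ∈ vertices N (picture N g)} with hA
  have hV : (vertices N (picture N g)).Finite := by
    rw [h.vertices_eq hN]; exact finite_range _
  have hfin : A.Finite := by
    refine (hV.preimage (f := fun t : ℝ => p + t • axis s.o) ?_).subset fun t ht => ht.2
    intro t _ u _ htu
    have := congrArg (par s.o) htu
    simpa using this
  have hmem : s.hi - par s.o p ∈ A := by
    refine ⟨sub_pos.2 (lt_of_le_of_ne hk.2.2 hne), ?_⟩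
    rw [h.vertices_eq hN]
    convert endpt_mem_range_node (N := N) (g := g) k true using 1
    rw [eq_iff_par s.o, ← hs, s.par_endpt, s.par_not_endpt]
    simp [Seg.bound, hk.1]
  obtain ⟨t, ht, hmin⟩ := hfin.exists_minimal ⟨_, hmem⟩
  have hle : ∀ u ∈ A, t ≤ u := fun u hu => (le_total t u).elim id (hmin hu)
  refine ⟨t, ht.1, ?_, hp, ht.2, ?_, ?_⟩
  · intro he
    have := congrArg (par s.o) he
    simp at this
    exact ht.1.ne' this
  · rw [segment_add_smul _ _ ht.1]
    rintro _ ⟨u, hu, rfl⟩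
    refine mem_iUnion.2 ⟨k, ?_, ?_⟩
    · rw [← hs]
      simpa using hk.1
    · have h1 := hle _ hmem
      have h2 := hk.2.1
      have := hu.1
      have := hu.2
      rw [← hs]
      simp only [par_add, par_smul, par_axis, mem_Icc]
      constructor <;> linarith
  · rw [openSegment_add_smul _ _ ht.1, disjoint_left]
    rintro _ ⟨u, hu, rfl⟩ hu'
    exact absurd (hle u ⟨hu.1, hu'⟩) (not_le.2 hu.2)

/-- The nearer of two different neighbours would be a vertex inside the edge to the farther one. -/
lemma next_unique {F : Set Plane} {p e : Plane} {t u : ℝ} (ht : 0 < t) (hu : 0 < u)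
    (h1 : (planarGraph N F).Adj p (p + t • e)) (h2 : (planarGraph N F).Adj p (p + u • e)) :
    t = u := by
  obtain ⟨-, -, hvt, -, hdt⟩ := h1
  obtain ⟨-, -, hvu, -, hdu⟩ := h2
  rw [openSegment_add_smul _ _ ht, disjoint_left] at hdt
  rw [openSegment_add_smul _ _ hu, disjoint_left] at hdu
  rcases lt_trichotomy t u with hlt | heq | hlt
  · exact absurd hvt (hdu ⟨t, ⟨ht, hlt⟩, rfl⟩)
  · exact heq
  · exact absurd hvu (hdt ⟨u, ⟨hu, hlt⟩, rfl⟩)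

lemma exists_outgoing {F : Set Plane} {a b : Plane} {c : Bool}
    (hab : (planarGraph N F).Adj a b) (hc : par (!c) a = par (!c) b) (hlt : par c a < par c b) :
    (a, c) ∈ outgoing N F ∧ ∃ t : ℝ, 0 < t ∧ b = a + t • axis c := by
  have hb := eq_add_smul_axis hc
  obtain ⟨-, ha, -, hs, -⟩ := hab
  refine ⟨⟨ha, mem_directions.2 ⟨c, true, rfl⟩, par c b - par c a, sub_pos.2 hlt, ?_⟩,
    _, sub_pos.2 hlt, hb⟩
  intro s hs'
  apply hs
  rw [hb, segment_add_smul _ _ (sub_pos.2 hlt)]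
  exact ⟨s, hs', rfl⟩

/-- Every edge is recorded by its lower or left end. -/
lemma encard_edgeSet_eq_outgoing (h : IsArrangement N g) (hN : 0 < N) [Finite J] :
    (planarGraph N (picture N g)).edgeSet.encard = (outgoing N (picture N g)).encard := by
  have hex : ∀ q, ∃ t : ℝ, q ∈ outgoing N (picture N g) →
      0 < t ∧ (planarGraph N (picture N g)).Adj q.1 (q.1 + t • axis q.2) := by
    intro q
    by_cases hq : q ∈ outgoing N (picture N g)
    · obtain ⟨t, ht⟩ := h.exists_next hN hq
      exact ⟨t, fun _ => ht⟩
    · exact ⟨0, fun h => absurd h hq⟩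
  choose τ hτ using hex
  have himage : (planarGraph N (picture N g)).edgeSet =
      (fun q : Plane × Bool => s(q.1, q.1 + τ q • axis q.2)) '' outgoing N (picture N g) := by
    ext e
    constructor
    · induction e using Sym2.ind with
      | _ a b =>
      intro hab
      rw [SimpleGraph.mem_edgeSet] at hab
      have key : ∀ a b : Plane, (planarGraph N (picture N g)).Adj a b →
          ∀ c, par (!c) a = par (!c) b → par c a < par c b →
          s(a, b) ∈ (fun q : Plane × Bool => s(q.1, q.1 + τ q • axis q.2)) ''
            outgoing N (picture N g) := by
        intro a b hab c hc hlt
        obtain ⟨hq, t, ht, rfl⟩ := exists_outgoing hab hc hlt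
        refine ⟨(a, c), hq, ?_⟩
        obtain ⟨h1, h2⟩ := hτ _ hq
        simp only at h1 h2 ⊢
        rw [next_unique h1 ht h2 hab]
      obtain ⟨c, hc⟩ := exists_par_eq hab.2.2.2.1
      rw [← Bool.not_not c] at hc
      rcases lt_trichotomy (par (!c) a) (par (!c) b) with hlt | heq | hlt
      · exact key a b hab _ hc hlt
      · exact absurd ((eq_iff_par (!c)).2 ⟨heq, hc⟩) hab.1
      · rw [Sym2.eq_swap]
        exact key b a hab.symm _ hc.symm hlt
    · rintro ⟨q, hq, rfl⟩
      exact (hτ q hq).2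
  rw [himage]
  apply InjOn.encard_image
  rintro ⟨p, b⟩ hq ⟨p', b'⟩ hq' heq
  have h1 := (hτ _ hq).1
  have h2 := (hτ _ hq').1
  simp only [Sym2.eq_iff] at heq h1 h2
  rcases heq with ⟨rfl, h3⟩ | ⟨h3, h4⟩
  · have h5 := congrArg (par b) (add_left_cancel h3)
    have : b = b' := by
      by_contra hne
      have hb : b = !b' := by revert hne; cases b <;> cases b' <;> simp
      rw [par_smul, par_axis, par_smul, hb, par_not_axis] at h5
      rw [hb] at h1
      linarith
    rw [this]
  -- Each of the two points would be reached from the other by a step in a positive direction.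
  · exfalso
    have h5 := congrArg (par b) h4
    have h7 := congrArg (par b) h3
    have h6 : 0 ≤ par b (axis b') := by cases b <;> cases b' <;> simp [par, axis]
    simp only [par_add, par_smul, par_axis] at h5 h7
    nlinarith [mul_nonneg h2.le h6]

/-- The number of edges of an arrangement. -/
theorem encard_edgeSet (h : IsArrangement N g) (hN : 0 < N) [Finite J] :
    (planarGraph N (picture N g)).edgeSet.encard = 3 * (Nat.card J : ℕ∞) + 4 := by
  rw [h.encard_edgeSet_eq_outgoing hN, h.encard_outgoing hN]

end IsArrangement

/-! ## Stopping times -/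

/-- Stopping times `T` such that `r` is stopped at the time `τ r r'` by those `r'` with `A r r'`
that are not stopped before the earlier time `τ r' r` exist and are unique. -/
theorem existsUnique_stopping {R : Type*} [Finite R] (A : R → R → Prop) (τ : R → R → ℝ)
    (hA : ∀ r r', A r r' → 0 < τ r r' ∧ τ r' r < τ r r') :
    ∃! T : R → ℝ≥0∞, ∀ r, T r = sInf {x | ∃ r', A r r' ∧ ENNReal.ofReal (τ r' r) ≤ T r' ∧
      x = ENNReal.ofReal (τ r r')} := by
  let lt : R × R → R × R → Prop := fun x y => τ x.1 x.2 < τ y.1 y.2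
  have : IsTrans (R × R) lt := ⟨fun _ _ _ => lt_trans⟩
  have : Std.Irrefl lt := ⟨fun _ => lt_irrefl _⟩
  have wf : WellFounded lt := Finite.wellFounded_of_trans_of_irrefl lt
  -- `hit (r, r')` says that `r'` really stops `r` if `r` gets that far: no `r''` hits `r'` before
  -- `r'` reaches the crossing. The times involved satisfy `τ r' r'' < τ r' r < τ r r'`, so the
  -- recursion descends.
  let step : ∀ x : R × R, (∀ y, lt y x → Prop) → Prop := fun x rec =>
    ∃ h : A x.1 x.2, ∀ r'', A x.2 r'' → ∀ h' : τ x.2 r'' < τ x.2 x.1,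
      ¬rec (x.2, r'') (h'.trans (hA _ _ h).2)
  let hit : R × R → Prop := wf.fix step
  have hit_iff : ∀ r r', hit (r, r') ↔
      A r r' ∧ ∀ r'', A r' r'' → τ r' r'' < τ r' r → ¬hit (r', r'') := by
    intro r r'
    have : hit (r, r') = step (r, r') fun y _ => hit y := wf.fix_eq step (r, r')
    rw [this]
    simp only [step, exists_prop]
  have key : ∀ (H : R → R → Prop), (∀ r r', H r r' → A r r') → ∀ r r',
      ENNReal.ofReal (τ r' r) ≤ sInf {x | ∃ r'', H r' r'' ∧ x = ENNReal.ofReal (τ r' r'')} ↔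
        ∀ r'', A r' r'' → τ r' r'' < τ r' r → ¬H r' r'' := by
    intro H hH r r'
    rw [le_sInf_iff]
    constructor
    · intro h r'' hA'' hlt hH''
      have h1 := h _ ⟨r'', hH'', rfl⟩
      -- Positivity of the times matters here, because `ENNReal.ofReal` sends all negative numbers
      -- to 0.
      rw [ENNReal.ofReal_le_ofReal_iff (hA _ _ hA'').1.le] at h1
      exact absurd h1 (not_le.2 hlt)
    · rintro h _ ⟨r'', hH'', rfl⟩
      apply ENNReal.ofReal_le_ofReal
      by_contra hlt
      exact h r'' (hH _ _ hH'') (not_le.1 hlt) hH''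
  refine ⟨fun r => sInf {x | ∃ r', hit (r, r') ∧ x = ENNReal.ofReal (τ r r')}, ?_, ?_⟩
  · intro r
    dsimp only
    congr 1
    ext x
    apply exists_congr
    intro r'
    rw [key (fun r r' => hit (r, r')) (fun r r' h => ((hit_iff r r').1 h).1) r r', ← and_assoc,
      ← hit_iff]
  · intro T hT
    have hH : ∀ x : R × R, (A x.1 x.2 ∧ ENNReal.ofReal (τ x.2 x.1) ≤ T x.2) ↔ hit x := by
      intro x
      induction x using wf.induction with
      | _ x ih =>
      obtain ⟨r, r'⟩ := x
      rw [hit_iff]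
      refine and_congr_right fun hAr => ?_
      have h1 : T r' = sInf {x | ∃ r'', (A r' r'' ∧ ENNReal.ofReal (τ r'' r') ≤ T r'') ∧
          x = ENNReal.ofReal (τ r' r'')} := by
        rw [hT r']
        simp only [and_assoc]
      rw [h1, key (fun r' r'' => A r' r'' ∧ ENNReal.ofReal (τ r'' r') ≤ T r'')
        (fun _ _ h => h.1) r r']
      refine forall_congr' fun r'' => forall_congr' fun _ => forall_congr' fun hlt => not_congr ?_
      exact ih (r', r'') (hlt.trans (hA _ _ hAr).2)
    funext r
    rw [hT r]
    simp only [← and_assoc]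
    simp only [← hH]

/-! ## Growth from seeds in general position -/

/-- Finitely many seeds in the interior of the square, no two of which share a coordinate or have
their coordinates at the same distance. -/
structure IsGeneric (N : ℝ) (S : Set (Plane × Plane)) : Prop where
  finite : S.Finite
  direction : ∀ s ∈ S, ∃ b, s.2 = axis b
  interior : ∀ s ∈ S, ∀ b, par b s.1 ∈ Ioo 0 N
  inj : ∀ s ∈ S, ∀ s' ∈ S, ∀ b, par b s.1 = par b s'.1 → s = s'
  diag : ∀ s ∈ S, ∀ s' ∈ S, s ≠ s' → ∀ b,
    |par b s.1 - par b s'.1| ≠ |par (!b) s.1 - par (!b) s'.1|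

open Classical in
/-- The axis of a seed. -/
noncomputable def orient (s : Plane × Plane) : Bool := decide (s.2 = axis true)

/-- The time at which the ray `x` reaches the line of a ray `y` of the other axis. -/
noncomputable def hitTime {S : Set (Plane × Plane)} (x y : S × Bool) : ℝ :=
  sgn x.2 * (par (orient x.1) y.1.1.1 - par (orient x.1) x.1.1.1)

/-- The line of `x` meets the line of `y` ahead of both, and `y` would be there before `x`. -/
def CanStop {S : Set (Plane × Plane)} (x y : S × Bool) : Prop :=
  orient y.1 = !orient x.1 ∧ 0 < hitTime y x ∧ hitTime y x < hitTime x y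

/-- The equation satisfied by the stopping times of the rays. -/
def IsStopping {S : Set (Plane × Plane)} (T : S × Bool → ℝ≥0∞) : Prop :=
  ∀ x, T x = sInf {t | ∃ y, CanStop x y ∧ ENNReal.ofReal (hitTime y x) ≤ T y ∧
    t = ENNReal.ofReal (hitTime x y)}

lemma sgn_mul_self (σ : Bool) : sgn σ * sgn σ = 1 := by cases σ <;> simp [sgn]

namespace IsGeneric

variable {N : ℝ} {S : Set (Plane × Plane)}

lemma snd_eq (h : IsGeneric N S) {s : Plane × Plane} (hs : s ∈ S) : s.2 = axis (orient s) := by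
  obtain ⟨b, hb⟩ := h.direction s hs
  cases b
  · have : s.2 ≠ axis true := by rw [hb]; simp [axis]
    rw [hb]; simp [orient, this]
  · rw [hb]; simp [orient, hb]

/-- The ray with a given seed and sign. -/
noncomputable def ray (h : IsGeneric N S) (x : S × Bool) : rays S :=
  ⟨(x.1.1.1, dir (orient x.1) x.2), by
    have hx : (x.1.1.1, axis (orient x.1)) ∈ S := by
      rw [← h.snd_eq x.1.2]; exact x.1.2
    rcases x with ⟨s, σ⟩
    cases σ
    · right; simpa [dir] using hx
    · left; simpa [dir] using hx⟩

lemma ray_bijective (h : IsGeneric N S) : Function.Bijective h.ray := by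
  constructor
  · rintro ⟨s, σ⟩ ⟨s', σ'⟩ heq
    have h1 := congrArg Subtype.val heq
    simp only [ray, Prod.mk.injEq] at h1
    have h2 : s = s' := Subtype.ext (h.inj _ s.2 _ s'.2 true (by rw [h1.1]))
    subst h2
    rw [(dir_inj.1 h1.2).2]
  · rintro ⟨⟨u, v⟩, hr⟩
    rcases hr with hr | hr
    · refine ⟨(⟨_, hr⟩, true), Subtype.ext ?_⟩
      have := h.snd_eq hr
      simp only [ray, dir]
      simpa using this.symm
    · refine ⟨(⟨_, hr⟩, false), Subtype.ext ?_⟩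
      have := h.snd_eq hr
      simp only [ray, dir]
      simp only at this
      simp [← this]

/-- The equivalence between pairs of a seed and a sign and rays. -/
noncomputable def rayEquiv (h : IsGeneric N S) : S × Bool ≃ rays S :=
  Equiv.ofBijective _ h.ray_bijective

lemma orient_eq_or (x y : S × Bool) :
    orient y.1 = orient x.1 ∨ orient y.1 = !orient x.1 := by
  cases orient y.1 <;> cases orient x.1 <;> simp

/-- General position excludes both equalities: the first would give two seeds a common coordinate,
the second would put them on a common diagonal. -/
lemma canStop_of_le (h : IsGeneric N S) {x y : S × Bool} (hxy : orient y.1 = !orient x.1)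
    (h0 : 0 ≤ hitTime y x) (h1 : hitTime y x ≤ hitTime x y) : CanStop x y := by
  have hne : (x.1 : Plane × Plane) ≠ y.1 := by
    intro he
    rw [he] at hxy
    cases hb : orient y.1 <;> simp [hb] at hxy
  refine ⟨hxy, lt_of_le_of_ne h0 fun he => ?_, lt_of_le_of_ne h1 fun he => ?_⟩
  · have : par (orient y.1) x.1.1.1 = par (orient y.1) y.1.1.1 := by
      unfold hitTime at he
      rcases y with ⟨y, σ⟩
      cases σ <;> simp [sgn] at he <;> linarith
    exact hne (h.inj _ x.1.2 _ y.1.2 _ this)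
  · refine h.diag _ x.1.2 _ y.1.2 hne (orient x.1) ?_
    have habs : ∀ (σ : Bool) (a b : ℝ), |sgn σ * (a - b)| = |a - b| := by
      intro σ a b
      cases σ
      · simp [sgn, abs_sub_comm]
      · simp [sgn]
    have h2 := congrArg abs he
    unfold hitTime at h2
    rw [habs, habs, hxy] at h2
    rw [h2, abs_sub_comm]

/-- Parallel rays of different seeds lie on different lines, and the opposite ray of the same seed
is never met at positive time. For perpendicular rays, comparing both coordinates identifies the two
times with `hitTime x y` and `hitTime y x`. -/
lemma tip_mem_rayAt_iff (h : IsGeneric N S) (T : rays S → ℝ≥0∞) (x y : S × Bool) (t : ℝ) :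
    (0 < t ∧ h.ray y ≠ h.ray x ∧ (h.ray x).1.1 + t • (h.ray x).1.2 ∈ rayAt T (h.ray y) t) ↔
      CanStop x y ∧ ENNReal.ofReal (hitTime y x) ≤ T (h.ray y) ∧ t = hitTime x y := by
  constructor
  · rintro ⟨ht, hne, s, hs0, hst, hsT, heq⟩
    simp only [ray] at heq
    have e1 := congrArg (par (orient x.1)) heq
    have e2 := congrArg (par (!orient x.1)) heq
    simp only [par_add, par_smul] at e1 e2
    rcases orient_eq_or x y with ho | ho
    · exfalso
      rw [ho] at e1 e2
      simp only [par_dir, par_not_dir, mul_zero, add_zero] at e1 e2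
      have hxy : x.1 = y.1 := Subtype.ext (h.inj _ x.1.2 _ y.1.2 _ e2)
      rw [hxy] at e1
      obtain ⟨i, σ⟩ := x
      obtain ⟨j, ρ⟩ := y
      simp only at hxy e1
      subst hxy
      cases σ <;> cases ρ <;> simp [sgn] at e1 hne <;> linarith
    · rw [ho] at e1 e2
      have h3 : par (orient x.1) (dir (!orient x.1) y.2) = 0 := by
        simpa using par_not_dir (!orient x.1) y.2
      simp only [par_dir, par_not_dir, h3, mul_zero, add_zero] at e1 e2
      have e3 : t = hitTime x y := by
        unfold hitTime
        linear_combination (sgn x.2) * e1 - t * sgn_mul_self x.2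
      have e4 : s = hitTime y x := by
        unfold hitTime
        rw [ho]
        linear_combination -(sgn y.2) * e2 - s * sgn_mul_self y.2
      subst e4
      exact ⟨h.canStop_of_le ho hs0 (e3 ▸ hst), hsT, e3⟩
  · rintro ⟨⟨ho, h0, hlt⟩, hT, rfl⟩
    refine ⟨h0.trans hlt, ?_, hitTime y x, h0.le, hlt.le, hT, ?_⟩
    · intro he
      rw [h.ray_bijective.1 he] at ho
      cases hb : orient x.1 <;> simp [hb] at ho
    · have h3 : par (orient x.1) (dir (!orient x.1) y.2) = 0 := by
        simpa using par_not_dir (!orient x.1) y.2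
      simp only [ray, ho]
      rw [eq_iff_par (orient x.1)]
      simp only [par_add, par_smul, par_dir, par_not_dir, h3, mul_zero, add_zero]
      unfold hitTime
      rw [ho]
      constructor
      · linear_combination (par (orient x.1) y.1.1.1 - par (orient x.1) x.1.1.1) *
          sgn_mul_self x.2
      · linear_combination -(par (!orient x.1) x.1.1.1 - par (!orient x.1) y.1.1.1) *
          sgn_mul_self y.2

lemma isGrowth_iff (h : IsGeneric N S) (T : rays S → ℝ≥0∞) :
    IsGrowth T ↔ IsStopping (fun x => T (h.ray x)) := by
  unfold IsGrowth IsStopping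
  rw [← h.rayEquiv.forall_congr_right]
  refine forall_congr' fun x => ?_
  have : h.rayEquiv x = h.ray x := rfl
  rw [this]
  suffices heq : (ENNReal.ofReal '' {t : ℝ | 0 < t ∧ ∃ r' : rays S, r' ≠ h.ray x ∧
      (h.ray x).1.1 + t • (h.ray x).1.2 ∈ rayAt T r' t}) =
      {t | ∃ y, CanStop x y ∧ ENNReal.ofReal (hitTime y x) ≤ T (h.ray y) ∧
        t = ENNReal.ofReal (hitTime x y)} by rw [heq]
  ext z
  constructor
  · rintro ⟨t, ⟨ht, r', hr'⟩, rfl⟩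
    obtain ⟨y, rfl⟩ := h.ray_bijective.2 r'
    obtain ⟨h1, h2, rfl⟩ := (h.tip_mem_rayAt_iff T x y t).1 ⟨ht, hr'⟩
    exact ⟨y, h1, h2, rfl⟩
  · rintro ⟨y, h1, h2, rfl⟩
    obtain ⟨h3, h4⟩ := (h.tip_mem_rayAt_iff T x y _).2 ⟨h1, h2, rfl⟩
    exact ⟨_, ⟨h3, h.ray y, h4⟩, rfl⟩

/-- The growth rule determines the process. -/
theorem existsUnique_growth (h : IsGeneric N S) : ∃! T : rays S → ℝ≥0∞, IsGrowth T := by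
  have : Finite S := h.finite
  obtain ⟨T, hT, huniq⟩ := existsUnique_stopping (R := S × Bool) CanStop hitTime
    fun x y hxy => ⟨hxy.2.1.trans hxy.2.2, hxy.2.2⟩
  refine ⟨fun r => T (h.rayEquiv.symm r), (h.isGrowth_iff _).2 ?_, ?_⟩
  · have : (fun x => T (h.rayEquiv.symm (h.ray x))) = T :=
      funext fun x => congrArg T (h.rayEquiv.symm_apply_apply x)
    rw [this]
    exact hT
  · intro T' hT'
    have := huniq _ ((h.isGrowth_iff _).1 hT')
    funext r
    rw [← this]
    exact congrArg T' (h.rayEquiv.apply_symm_apply r).symm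

end IsGeneric

/-! ## The final configuration -/

/-- The coordinate at which the ray `x` stops or leaves the square. -/
noncomputable def stopCoord (N : ℝ) {S : Set (Plane × Plane)} (T : S × Bool → ℝ≥0∞)
    (x : S × Bool) : ℝ :=
  if T x = ∞ then (if x.2 then N else 0)
  else par (orient x.1) x.1.1.1 + sgn x.2 * (T x).toReal

/-- The segment formed by the two rays of a seed inside the square. -/
noncomputable def seedSeg (N : ℝ) {S : Set (Plane × Plane)} (T : S × Bool → ℝ≥0∞) (i : S) : Seg :=
  ⟨orient i, par (!orient i) i.1.1, stopCoord N T (i, false), stopCoord N T (i, true)⟩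

lemma bound_seedSeg (N : ℝ) {S : Set (Plane × Plane)} (T : S × Bool → ℝ≥0∞) (i : S) (σ : Bool) :
    (seedSeg N T i).bound σ = stopCoord N T (i, σ) := by
  cases σ <;> rfl

@[simp] lemma seedSeg_lo (N : ℝ) {S : Set (Plane × Plane)} (T : S × Bool → ℝ≥0∞) (i : S) :
    (seedSeg N T i).lo = stopCoord N T (i, false) := rfl

@[simp] lemma seedSeg_hi (N : ℝ) {S : Set (Plane × Plane)} (T : S × Bool → ℝ≥0∞) (i : S) :
    (seedSeg N T i).hi = stopCoord N T (i, true) := rfl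

lemma mem_square_iff {N : ℝ} {p : Plane} (b : Bool) :
    p ∈ square N ↔ par b p ∈ Icc 0 N ∧ par (!b) p ∈ Icc 0 N := by
  cases b
  · exact mem_prod.trans and_comm
  · exact mem_prod

lemma frontier_square {N : ℝ} (hN : 0 < N) :
    frontier (square N) = ⋃ k, (side N k).carrier := by
  rw [square, frontier_prod_eq, closure_Icc, frontier_Icc hN.le]
  ext ⟨x, y⟩
  simp only [mem_union, mem_prod, mem_iUnion, Prod.exists, Bool.exists_bool, side, Seg.carrier, par]
  simp
  tauto

namespace IsGeneric

variable {N : ℝ} {S : Set (Plane × Plane)}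

lemma hitTime_pos_iff {x y : S × Bool} :
    0 < hitTime x y ↔
      sgn x.2 * par (orient x.1) x.1.1.1 < sgn x.2 * par (orient x.1) y.1.1.1 := by
  unfold hitTime
  rw [mul_sub, sub_pos]

variable {T : S × Bool → ℝ≥0∞}

lemma stop_le (hT : IsStopping T) {x y : S × Bool} (hxy : CanStop x y)
    (hy : ENNReal.ofReal (hitTime y x) ≤ T y) : T x ≤ ENNReal.ofReal (hitTime x y) := by
  rw [hT x]
  exact sInf_le ⟨y, hxy, hy, rfl⟩

/-- The infimum runs over a finite set, so it is attained unless the set is empty. -/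
lemma stop_eq (h : IsGeneric N S) (hT : IsStopping T) (x : S × Bool) :
    T x = ∞ ∨ ∃ y, CanStop x y ∧ ENNReal.ofReal (hitTime y x) ≤ T y ∧
      T x = ENNReal.ofReal (hitTime x y) := by
  have : Finite S := h.finite
  set A := {t | ∃ y, CanStop x y ∧ ENNReal.ofReal (hitTime y x) ≤ T y ∧
      t = ENNReal.ofReal (hitTime x y)} with hA
  have hTx : T x = sInf A := hT x
  rcases A.eq_empty_or_nonempty with he | hne
  · left
    rw [hTx, he, sInf_empty]
  · right
    have hfin : A.Finite := (finite_range fun y => ENNReal.ofReal (hitTime x y)).subset (by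
      rintro _ ⟨y, -, -, rfl⟩
      exact ⟨y, rfl⟩)
    have := hne.csInf_mem hfin
    rw [← hTx] at this
    exact this

lemma stopCoord_of_eq {x y : S × Bool} (hx : T x = ENNReal.ofReal (hitTime x y))
    (h0 : 0 ≤ hitTime x y) : stopCoord N T x = par (orient x.1) y.1.1.1 := by
  unfold stopCoord
  rw [if_neg (by rw [hx]; exact ENNReal.ofReal_ne_top), hx, ENNReal.toReal_ofReal h0]
  unfold hitTime
  linear_combination (par (orient x.1) y.1.1.1 - par (orient x.1) x.1.1.1) * sgn_mul_self x.2

lemma stopCoord_cases (h : IsGeneric N S) (hT : IsStopping T) (x : S × Bool) :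
    (T x = ∞ ∧ stopCoord N T x = if x.2 then N else 0) ∨
      ∃ y, CanStop x y ∧ ENNReal.ofReal (hitTime y x) ≤ T y ∧
        T x = ENNReal.ofReal (hitTime x y) ∧ stopCoord N T x = par (orient x.1) y.1.1.1 := by
  rcases h.stop_eq hT x with hx | ⟨y, h1, h2, h3⟩
  · left
    exact ⟨hx, by rw [stopCoord, if_pos hx]⟩
  · right
    exact ⟨y, h1, h2, h3, stopCoord_of_eq h3 (h1.2.1.trans h1.2.2).le⟩

/-- A stopped ray ends at the coordinate of another seed; thus no ray is stopped outside the square.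
-/
lemma stopCoord_mem (h : IsGeneric N S) (hN : 0 < N) (hT : IsStopping T) (x : S × Bool) :
    stopCoord N T x ∈ Icc 0 N := by
  rcases h.stopCoord_cases hT x with ⟨-, hx⟩ | ⟨y, -, -, -, hx⟩ <;> rw [hx]
  · cases x.2 <;> simp [hN.le]
  · exact Ioo_subset_Icc_self (h.interior _ y.1.2 _)

lemma lt_stopCoord (h : IsGeneric N S) (hT : IsStopping T) (x : S × Bool) :
    sgn x.2 * par (orient x.1) x.1.1.1 < sgn x.2 * stopCoord N T x := by
  rcases h.stopCoord_cases hT x with ⟨-, hx⟩ | ⟨y, h1, -, -, hx⟩ <;> rw [hx]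
  · have := h.interior _ x.1.2 (orient x.1)
    rcases x with ⟨i, σ⟩
    cases σ <;> simp [sgn] <;> [exact this.1; exact this.2]
  · exact hitTime_pos_iff.1 (h1.2.1.trans h1.2.2)

lemma seedSeg_lo_lt (h : IsGeneric N S) (hT : IsStopping T) (i : S) :
    (seedSeg N T i).lo < par (orient i) i.1.1 := by
  have := h.lt_stopCoord hT (i, false)
  simp only [sgn] at this
  simp at this
  exact this

lemma seedSeg_lt_hi (h : IsGeneric N S) (hT : IsStopping T) (i : S) :
    par (orient i) i.1.1 < (seedSeg N T i).hi := by
  have := h.lt_stopCoord hT (i, true)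
  simp only [sgn] at this
  simp at this
  exact this

/-- The ray `x` reaches the coordinates between its seed and its stopping point. -/
lemma le_stop_iff (x : S × Bool) {v : ℝ} (hv : v ∈ Icc 0 N)
    (h0 : 0 ≤ sgn x.2 * (v - par (orient x.1) x.1.1.1)) :
    ENNReal.ofReal (sgn x.2 * (v - par (orient x.1) x.1.1.1)) ≤ T x ↔
      sgn x.2 * v ≤ sgn x.2 * stopCoord N T x := by
  unfold stopCoord
  by_cases hx : T x = ∞
  · rw [if_pos hx, hx]
    rcases x with ⟨i, σ⟩
    cases σ <;> simp [sgn] <;> [exact hv.1; exact hv.2]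
  · rw [if_neg hx, ENNReal.ofReal_le_iff_le_toReal hx, mul_add, ← mul_assoc, sgn_mul_self]
    constructor <;> intro <;> linarith

/-- A ray that stops another one grows beyond the point of contact. -/
lemma stopCoord_ne (h : IsGeneric N S) (hT : IsStopping T) {x y : S × Bool} (hxy : CanStop x y) :
    stopCoord N T y ≠ par (orient y.1) x.1.1.1 := by
  intro he
  have hc := h.interior _ x.1.2 (orient y.1)
  rcases h.stopCoord_cases hT y with ⟨-, hy⟩ | ⟨z, h1, -, -, hy⟩
  · rw [← he, hy] at hc
    cases hb : y.2 <;> simp [hb] at hc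
  -- A ray `z` stopping `y` at this point would come from the seed of `x`. Being ahead of `y` forces
  -- `z = x`, and then each of `x` and `y` would arrive before the other.
  · have hzx : z.1 = x.1 := Subtype.ext (h.inj _ z.1.2 _ x.1.2 _ (hy.symm.trans he))
    obtain ⟨i, σ⟩ := x
    obtain ⟨i', ρ⟩ := z
    simp only at hzx
    subst hzx
    have h2 : hitTime y (i', σ) = hitTime y (i', ρ) := rfl
    obtain ⟨-, h3, h4⟩ := h1
    obtain ⟨-, h5, h6⟩ := hxy
    unfold hitTime at h2 h3 h4 h5 h6
    cases σ <;> cases ρ <;> simp [sgn] at h3 h4 h5 h6 <;> linarith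

/-- For `ends`, the ray `y` that stops a ray passes strictly beyond the contact point by
`stopCoord_ne`, so this point is interior to the segment of `y`. For `cross`, the later of the two
rays arriving at a common point stops there. -/
lemma isArrangement (h : IsGeneric N S) (hN : 0 < N) (hT : IsStopping T) :
    IsArrangement N (seedSeg N T) where
  lt i := (h.seedSeg_lo_lt hT i).trans (h.seedSeg_lt_hi hT i)
  lo_nonneg i := (h.stopCoord_mem hN hT _).1
  hi_le i := (h.stopCoord_mem hN hT _).2
  c_mem i := h.interior _ i.2 _
  inj i j ho hc := by
    simp only [seedSeg] at ho hc
    rw [ho] at hc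
    exact Subtype.ext (h.inj _ i.2 _ j.2 _ hc)
  ends i σ := by
    rw [bound_seedSeg]
    rcases h.stopCoord_cases hT (i, σ) with ⟨-, hx⟩ | ⟨y, h1, h2, -, hx⟩
    · exact ⟨Sum.inr (!orient i, σ), rfl, by rw [hx]; rfl, h.interior _ i.2 _⟩
    · refine ⟨Sum.inl y.1, h1.1, ?_, ?_⟩
      · rw [hx]
        change par (!orient y.1) y.1.1.1 = _
        rw [h1.1, Bool.not_not]
      · have hpos := h1.2.1
        have hc : (seedSeg N T i).c = par (orient y.1) i.1.1 := by
          rw [h1.1]; rfl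
        have h3 := (le_stop_iff (T := T) y (Ioo_subset_Icc_self (h.interior _ i.2 (orient y.1)))
          h1.2.1.le).1 h2
        have h4 := h.stopCoord_ne hT h1
        have h5 := h.seedSeg_lo_lt hT y.1
        have h6 := h.seedSeg_lt_hi hT y.1
        rw [hitTime_pos_iff] at hpos
        simp only [full, Sum.elim_inl, hc, mem_Ioo]
        obtain ⟨j, ρ⟩ := y
        cases ρ
        · have h4' : stopCoord N T (j, false) < par (orient j) i.1.1 :=
            lt_of_le_of_ne (by simpa [sgn] using h3) h4
          have : par (orient j) i.1.1 < par (orient j) j.1.1 := by simpa [sgn] using hpos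
          exact ⟨h4', this.trans h6⟩
        · have h4' : par (orient j) i.1.1 < stopCoord N T (j, true) :=
            lt_of_le_of_ne (by simpa [sgn] using h3) (Ne.symm h4)
          have : par (orient j) j.1.1 < par (orient j) i.1.1 := by simpa [sgn] using hpos
          exact ⟨h5.trans this, h4'⟩
  cross i j ho hj hi := by
    have ho' : orient j = !orient i := ho
    have hij : i ≠ j := by
      rintro rfl
      cases hb : orient i <;> simp [hb] at ho'
    have hcj : (seedSeg N T j).c = par (orient i) j.1.1 := by
      change par (!orient j) j.1.1 = _
      rw [ho', Bool.not_not]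
    have hci : (seedSeg N T i).c = par (orient j) i.1.1 := by
      rw [ho']; rfl
    -- The sign `σ` selects the ray of `i` that points towards the crossing. The sign `ρ` is a
    -- dummy: `hitTime (i, σ) (j, ρ)` uses only the seed `j`.
    have key : ∀ i j : S, i ≠ j → par (orient i) j.1.1 ∈ Icc (seedSeg N T i).lo (seedSeg N T i).hi →
        ∃ σ, ∀ ρ, 0 < hitTime (i, σ) (j, ρ) ∧
          ENNReal.ofReal (hitTime (i, σ) (j, ρ)) ≤ T (i, σ) := by
      intro i j hij hmem
      have hne : par (orient i) i.1.1 ≠ par (orient i) j.1.1 := fun he =>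
        hij (Subtype.ext (h.inj _ i.2 _ j.2 _ he))
      have : ∀ σ, 0 < sgn σ * (par (orient i) j.1.1 - par (orient i) i.1.1) →
          ∀ ρ, 0 < hitTime (i, σ) (j, ρ) ∧
          ENNReal.ofReal (hitTime (i, σ) (j, ρ)) ≤ T (i, σ) := by
        intro σ hσ ρ
        refine ⟨hσ, (le_stop_iff (N := N) (i, σ)
          (Ioo_subset_Icc_self (h.interior _ j.2 (orient i))) hσ.le).2 ?_⟩
        cases σ
        · simpa [sgn] using hmem.1
        · simpa [sgn] using hmem.2
      rcases lt_or_gt_of_ne hne with hlt | hlt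
      · exact ⟨true, this true (by simpa [sgn] using hlt)⟩
      · exact ⟨false, this false (by simpa [sgn] using hlt)⟩
    rw [hcj] at hj
    rw [hci] at hi
    obtain ⟨σ, hσ⟩ := key i j hij hj
    obtain ⟨ρ, hρ⟩ := key j i hij.symm hi
    have fin : ∀ x y : S × Bool, CanStop x y → ENNReal.ofReal (hitTime y x) ≤ T y →
        ENNReal.ofReal (hitTime x y) ≤ T x → par (orient x.1) y.1.1.1 = stopCoord N T x :=
      fun x y h1 h2 h3 =>
        (stopCoord_of_eq (le_antisymm (stop_le hT h1 h2) h3) (h1.2.1.trans h1.2.2).le).symm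
    rcases le_total (hitTime (j, ρ) (i, σ)) (hitTime (i, σ) (j, ρ)) with hle | hle
    · left
      have hcan : CanStop (i, σ) (j, ρ) := h.canStop_of_le ho' (hρ σ).1.le hle
      exact ⟨σ, by rw [bound_seedSeg, hcj]; exact fin _ _ hcan (hρ σ).2 (hσ ρ).2⟩
    · right
      have hcan : CanStop (j, ρ) (i, σ) :=
        h.canStop_of_le (x := (j, ρ)) (y := (i, σ)) (by simp [ho']) (hσ ρ).1.le hle
      exact ⟨ρ, by rw [bound_seedSeg, hci]; exact fin _ _ hcan (hσ ρ).2 (hρ σ).2⟩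

/-- Time `N` is late enough: seeds are interior, so every point of the square on a ray is at
distance less than `N` from its seed. -/
lemma mem_seedSeg_iff (h : IsGeneric N S) (hN : 0 < N) {T : rays S → ℝ≥0∞}
    (hT : IsStopping fun x => T (h.ray x)) (i : S) (p : Plane) :
    p ∈ (seedSeg N (fun x => T (h.ray x)) i).carrier ↔
      p ∈ square N ∧ ∃ σ, p ∈ rayAt T (h.ray (i, σ)) N := by
  have hu := h.interior _ i.2 (orient i)
  have hlo := h.seedSeg_lo_lt hT i
  have hhi := h.seedSeg_lt_hi hT i
  constructor
  · rintro ⟨hc, hp⟩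
    change par (!orient i) p = par (!orient i) i.1.1 at hc
    change par (orient i) p ∈ _ at hp
    have hpN : par (orient i) p ∈ Icc 0 N :=
      ⟨(h.stopCoord_mem hN hT (i, false)).1.trans hp.1,
        hp.2.trans (h.stopCoord_mem hN hT (i, true)).2⟩
    refine ⟨(mem_square_iff (orient i)).2 ⟨hpN, ?_⟩, ?_⟩
    · rw [hc]
      exact Ioo_subset_Icc_self (h.interior _ i.2 _)
    have key : ∀ σ, 0 ≤ sgn σ * (par (orient i) p - par (orient i) i.1.1) →
        sgn σ * par (orient i) p ≤ sgn σ * stopCoord N (fun x => T (h.ray x)) (i, σ) →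
        p ∈ rayAt T (h.ray (i, σ)) N := by
      intro σ h0 hle
      refine ⟨_, h0, ?_, (le_stop_iff (i, σ) hpN h0).2 hle, ?_⟩
      · have := hpN.1
        have := hpN.2
        have := hu.1
        have := hu.2
        cases σ <;> simp [sgn] <;> linarith
      · rw [eq_iff_par (orient i)]
        simp only [ray, par_add, par_smul, par_dir, par_not_dir]
        constructor
        · linear_combination -(par (orient i) p - par (orient i) i.1.1) * sgn_mul_self σ
        · linear_combination hc
    rcases le_total (par (orient i) i.1.1) (par (orient i) p) with hle | hle
    · refine ⟨true, key true ?_ ?_⟩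
      · simpa [sgn] using hle
      · simpa [sgn] using hp.2
    · refine ⟨false, key false ?_ ?_⟩
      · simpa [sgn] using hle
      · simpa [sgn] using hp.1
  · rintro ⟨hsq, σ, s, hs0, hsN, hsT, rfl⟩
    have hpN := ((mem_square_iff (orient i)).1 hsq).1
    simp only [ray, par_add, par_smul, par_dir] at hpN
    refine ⟨?_, ?_⟩
    · simp [seedSeg, ray]
    have he : par (orient i) ((h.ray (i, σ)).1.1 + s • (h.ray (i, σ)).1.2) =
        par (orient i) i.1.1 + s * sgn σ := by simp [ray]
    change par (orient i) _ ∈ _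
    rw [he]
    have hs : sgn σ * (par (orient i) i.1.1 + s * sgn σ - par (orient i) i.1.1) = s := by
      linear_combination s * sgn_mul_self σ
    have h1 := (le_stop_iff (T := fun x => T (h.ray x)) (i, σ) hpN (by rw [hs]; exact hs0)).1
      (by rw [hs]; exact hsT)
    cases σ
    · simp only [sgn] at h1 ⊢
      simp at h1 hhi ⊢
      constructor <;> linarith
    · simp only [sgn] at h1 ⊢
      simp at h1 hlo ⊢
      constructor <;> linarith

lemma drawing_eq (h : IsGeneric N S) (hN : 0 < N) {T : rays S → ℝ≥0∞}
    (hT : IsStopping fun x => T (h.ray x)) :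
    drawing T N = picture N (seedSeg N fun x => T (h.ray x)) := by
  rw [drawing, frontier_square hN, picture, iUnion_sum]
  congr 1
  ext p
  simp only [config, mem_inter_iff, mem_iUnion, full, Sum.elim_inl, h.mem_seedSeg_iff hN hT]
  constructor
  · rintro ⟨⟨r, hr⟩, hp⟩
    obtain ⟨⟨i, σ⟩, rfl⟩ := h.ray_bijective.2 r
    exact ⟨i, hp, σ, hr⟩
  · rintro ⟨i, hp, σ, hr⟩
    exact ⟨⟨_, hr⟩, hp⟩

/-- The number of edges of the planar graph drawn from seeds in general position. -/
theorem encard_edgeSet (h : IsGeneric N S) (hN : 0 < N) {T : rays S → ℝ≥0∞} (hT : IsGrowth T) :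
    (planarGraph N (drawing T N)).edgeSet.encard = 3 * S.encard + 4 := by
  have : Finite S := h.finite
  rw [h.isGrowth_iff] at hT
  rw [h.drawing_eq hN hT, (h.isArrangement hN hT).encard_edgeSet hN, encard, ENat.card_eq_coe_natCard]

end IsGeneric

/-! ## Almost sure properties of the Poisson process -/

namespace IsPoissonProcess

variable {Ω : Type*} [MeasurableSpace Ω] {P : Measure Ω} {lam : ℝ} {X : ℕ → Ω → Plane}

/-- Having `k` points in `B` means that the set of their indices is one of the countably many finite
sets of size `k`. -/
lemma measurableSet_count_eq (h : IsPoissonProcess P lam X) {B : Set Plane}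
    (hB : MeasurableSet B) (k : ℕ) : MeasurableSet {ω | count X B ω = k} := by
  have : {ω | count X B ω = k} =
      ⋃ s : {s : Finset ℕ // s.card = k}, ⋂ i, {ω | X i ω ∈ B ↔ i ∈ s.1} := by
    ext ω
    simp only [count, mem_ofPred_eq, mem_iUnion, mem_iInter]
    constructor
    · intro hk
      have hfin : {i | X i ω ∈ B}.Finite := finite_of_encard_eq_coe hk
      refine ⟨⟨hfin.toFinset, ?_⟩, fun i => by simp⟩
      rw [hfin.encard_eq_coe_toFinset_card] at hk
      exact_mod_cast hk
    · rintro ⟨⟨s, rfl⟩, hs⟩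
      rw [← encard_coe_eq_coe_finsetCard]
      congr 1
      ext i
      exact hs i
  rw [this]
  refine MeasurableSet.iUnion fun s => MeasurableSet.iInter fun i => ?_
  by_cases hi : i ∈ s.1
  · simp only [hi, iff_true]
    exact h.measurable i hB
  · simp only [hi, iff_false]
    exact (h.measurable i hB).compl

variable [IsProbabilityMeasure P]

/-- The Poisson weights of the finite counts already add up to 1. -/
lemma ae_finite (h : IsPoissonProcess P lam X) {B : Set Plane} (hB : MeasurableSet B)
    (hv : volume B ≠ ∞) : ∀ᵐ ω ∂P, {i | X i ω ∈ B}.Finite := by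
  have h1 : P (⋃ k : ℕ, {ω | count X B ω = k}) = 1 := by
    rw [measure_iUnion _ fun k => h.measurableSet_count_eq hB k]
    · simp_rw [h.law B hB hv]
      rw [← measure_iUnion _ fun k => measurableSet_singleton k]
      · rw [iUnion_of_singleton, measure_univ]
      · intro k l hkl
        simpa using hkl
    · intro k l hkl
      refine disjoint_left.2 fun ω hk hl => hkl ?_
      have : (k : ℕ∞) = l := Eq.trans (Eq.symm hk) hl
      exact_mod_cast this
  have h2 := (mem_ae_iff_prob_eq_one
    (MeasurableSet.iUnion fun k => h.measurableSet_count_eq hB k)).2 h1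
  filter_upwards [h2] with ω hω
  obtain ⟨k, hk⟩ := mem_iUnion.1 hω
  exact finite_of_encard_eq_coe hk

lemma ae_notMem (h : IsPoissonProcess P lam X) {B : Set Plane} (hB : MeasurableSet B)
    (hv : volume B = 0) : ∀ᵐ ω ∂P, ∀ i, X i ω ∉ B := by
  have h1 : P {ω | count X B ω = (0 : ℕ)} = 1 := by
    rw [h.law B hB (by simp [hv]), poissonMeasure_singleton, hv]
    simp
  have h2 := (mem_ae_iff_prob_eq_one (h.measurableSet_count_eq hB 0)).2 h1
  filter_upwards [h2] with ω hω i hi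
  have h3 : {i | X i ω ∈ B} = ∅ := by
    rw [← encard_eq_zero]
    exact_mod_cast hω
  have h4 : i ∈ {i | X i ω ∈ B} := hi
  rw [h3] at h4
  exact h4

lemma measure_one_lt_count_le (h : IsPoissonProcess P lam X) (hlam : 0 ≤ lam) {B : Set Plane}
    (hB : MeasurableSet B) {v : ℝ} (hv0 : 0 ≤ v) (hv : volume B ≤ ENNReal.ofReal v) :
    P {ω | 1 < count X B ω} ≤ ENNReal.ofReal ((lam * v) ^ 2) := by
  have hfin : volume B ≠ ∞ := ne_top_of_le_ne_top ENNReal.ofReal_ne_top hv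
  have hm0 := h.measurableSet_count_eq hB 0
  have hm1 := h.measurableSet_count_eq hB 1
  have hset : {ω | 1 < count X B ω} =
      ({ω | count X B ω = (0 : ℕ)} ∪ {ω | count X B ω = (1 : ℕ)})ᶜ := by
    ext ω
    simp only [mem_ofPred_eq, mem_compl_iff, mem_union, not_or, Nat.cast_zero, Nat.cast_one]
    constructor
    · intro h1
      exact ⟨(zero_lt_one.trans h1).ne', h1.ne'⟩
    · rintro ⟨h0, h1⟩
      exact lt_of_le_of_ne (Order.one_le_iff_ne_zero.2 h0) (Ne.symm h1)
  have hdisj : Disjoint {ω | count X B ω = (0 : ℕ)} {ω | count X B ω = (1 : ℕ)} := by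
    refine disjoint_left.2 fun ω h0 h1 => ?_
    have : ((0 : ℕ) : ℕ∞) = (1 : ℕ) := Eq.trans (Eq.symm h0) h1
    exact absurd this (by simp)
  set μ : ℝ := lam * (volume B).toReal with hμ
  have hμ0 : 0 ≤ μ := mul_nonneg hlam ENNReal.toReal_nonneg
  have hμv : μ ≤ lam * v :=
    mul_le_mul_of_nonneg_left (ENNReal.toReal_le_of_le_ofReal hv0 hv) hlam
  rw [hset, prob_compl_eq_one_sub (hm0.union hm1), measure_union hdisj hm1, h.law B hB hfin,
    h.law B hB hfin, poissonMeasure_singleton, poissonMeasure_singleton, tsub_le_iff_right,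
    ← hμ, Real.coe_toNNReal _ hμ0, ← ENNReal.ofReal_add (by positivity) (by positivity),
    ← ENNReal.ofReal_add (by positivity) (by positivity), ENNReal.one_le_ofReal]
  -- From `exp (-μ) ≥ 1 - μ` follows `1 - exp (-μ) * (1 + μ) ≤ 1 - (1 - μ) * (1 + μ) = μ ^ 2`.
  have h1 := Real.add_one_le_exp (-μ)
  have h2 : μ ^ 2 ≤ (lam * v) ^ 2 := by gcongr
  simp
  nlinarith

/-- A function whose level sets are uniformly thin does not take the same value at two points. -/
lemma ae_injOn (h : IsPoissonProcess P lam X) (hlam : 0 ≤ lam) {Q : Set Plane}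
    (hQ : MeasurableSet Q) {f : Plane → ℝ} (hf : Measurable f) {M : ℕ}
    (hM : ∀ p ∈ Q, f p ∈ Ico (-M : ℝ) M) {C : ℝ} (hC : 0 ≤ C)
    (hvol : ∀ a b, a ≤ b → volume (Q ∩ f ⁻¹' Ico a b) ≤ ENNReal.ofReal (C * (b - a))) :
    ∀ᵐ ω ∂P, ∀ i j, X i ω ∈ Q → X j ω ∈ Q → f (X i ω) = f (X j ω) → i = j := by
  set bad : Set Ω := {ω | ¬∀ i j, X i ω ∈ Q → X j ω ∈ Q → f (X i ω) = f (X j ω) → i = j}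
  -- Two points with equal value lie in a common one of `2 * m * M` strips of width `1 / m`. Each
  -- strip holds two points with probability at most `(lam * C / m) ^ 2`, so the union bound is of
  -- order `1 / m`.
  have key : ∀ m : ℕ, 0 < m → P bad ≤ ENNReal.ofReal (2 * M * (lam * C) ^ 2 / m) := by
    intro m hm
    have hm' : (0 : ℝ) < m := by exact_mod_cast hm
    let strip : ℤ → Set Plane := fun k => Q ∩ f ⁻¹' Ico (k / m : ℝ) ((k + 1) / m)
    have hsub : bad ⊆ ⋃ k ∈ Finset.Ico (-(m * M : ℕ) : ℤ) (m * M : ℕ),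
        {ω | 1 < count X (strip k) ω} := by
      intro ω hω
      simp only [bad, mem_ofPred_eq] at hω
      push Not at hω
      obtain ⟨i, j, hi, hj, hij, hne⟩ := hω
      have hr := hM _ hi
      simp only [mem_iUnion]
      have hmem : ∀ p ∈ Q, p ∈ strip ⌊m * f p⌋ := by
        intro p hp
        refine ⟨hp, ?_, ?_⟩
        · rw [div_le_iff₀ hm', mul_comm]
          exact Int.floor_le _
        · rw [lt_div_iff₀ hm', mul_comm]
          exact Int.lt_floor_add_one _
      refine ⟨⌊m * f (X i ω)⌋, ?_, ?_⟩
      · rw [Finset.mem_Ico, Int.le_floor, Int.floor_lt]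
        push_cast
        constructor
        · nlinarith [hr.1]
        · exact mul_lt_mul_of_pos_left hr.2 hm'
      · refine one_lt_encard_iff.2 ⟨i, j, hmem _ hi, ?_, hne⟩
        rw [hij]
        exact hmem _ hj
    refine (measure_mono hsub).trans ((measure_biUnion_finset_le _ _).trans ?_)
    have hstrip : ∀ k ∈ Finset.Ico (-(m * M : ℕ) : ℤ) (m * M : ℕ),
        P {ω | 1 < count X (strip k) ω} ≤ ENNReal.ofReal ((lam * (C * (1 / m))) ^ 2) := by
      intro k _
      refine h.measure_one_lt_count_le hlam (hQ.inter (hf measurableSet_Ico)) (by positivity) ?_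
      refine (hvol _ _ ?_).trans (le_of_eq ?_)
      · gcongr; linarith
      · congr 2; ring
    refine (Finset.sum_le_card_nsmul _ _ _ hstrip).trans (le_of_eq ?_)
    rw [Int.card_Ico, nsmul_eq_mul, ← ENNReal.ofReal_natCast, ← ENNReal.ofReal_mul (by positivity)]
    congr 1
    have : ((((m * M : ℕ) : ℤ) - -((m * M : ℕ) : ℤ)).toNat) = 2 * (m * M) := by omega
    rw [this]
    push_cast
    field_simp
  have hlim : Filter.Tendsto (fun m : ℕ => ENNReal.ofReal (2 * M * (lam * C) ^ 2 / m))
      Filter.atTop (nhds 0) := by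
    have := ENNReal.tendsto_ofReal
      (tendsto_const_div_atTop_nhds_zero_nat (2 * M * (lam * C) ^ 2))
    rwa [ENNReal.ofReal_zero] at this
  rw [ae_iff]
  refine le_antisymm (ge_of_tendsto hlim ?_) (zero_le)
  filter_upwards [Filter.eventually_gt_atTop 0] with m hm
  exact key m hm

end IsPoissonProcess

/-! ## General position of the seeds -/

lemma measurableSet_square (N : ℝ) : MeasurableSet (square N) :=
  measurableSet_Icc.prod measurableSet_Icc

lemma volume_square_ne_top (N : ℝ) : volume (square N) ≠ ∞ := by
  rw [square, Measure.volume_eq_prod, Measure.prod_prod, Real.volume_Icc]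
  exact ENNReal.mul_ne_top ENNReal.ofReal_ne_top ENNReal.ofReal_ne_top

lemma volume_frontier_square (N : ℝ) : volume (frontier (square N)) = 0 :=
  ((convex_Icc 0 N).prod (convex_Icc 0 N)).addHaar_frontier _

/-- Fubini over horizontal lines: each section is contained in an interval of length `b - a`, and
only heights in `[0, N]` contribute. The coefficient 1 of `p.1` is essential, so the function `p.2`
needs its own bound. -/
lemma volume_strip_le {N : ℝ} (hN : 0 ≤ N) (α : ℝ) {a b : ℝ} :
    volume (square N ∩ (fun p : Plane => p.1 + α * p.2) ⁻¹' Ico a b) ≤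
      ENNReal.ofReal (N * (b - a)) := by
  have hmeas : MeasurableSet (square N ∩ (fun p : Plane => p.1 + α * p.2) ⁻¹' Ico a b) :=
    (measurableSet_square N).inter
      ((measurable_fst.add (measurable_snd.const_mul α)) measurableSet_Ico)
  rw [Measure.volume_eq_prod, Measure.prod_apply_symm hmeas]
  calc _ ≤ ∫⁻ y, (Icc 0 N).indicator (fun _ => ENNReal.ofReal (b - a)) y := by
        refine lintegral_mono fun y => ?_
        by_cases hy : y ∈ Icc 0 N
        · rw [indicator_of_mem hy]
          have : (fun x => (x, y)) ⁻¹' (square N ∩ (fun p : Plane => p.1 + α * p.2) ⁻¹' Ico a b) ⊆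
              Ico (a - α * y) (b - α * y) := by
            rintro x ⟨-, h1, h2⟩
            simp only at h1 h2
            exact ⟨by linarith, by linarith⟩
          refine (measure_mono this).trans (le_of_eq ?_)
          rw [Real.volume_Ico]
          congr 1
          ring
        · rw [indicator_of_notMem hy]
          have : (fun x => (x, y)) ⁻¹' (square N ∩ (fun p : Plane => p.1 + α * p.2) ⁻¹' Ico a b) =
              ∅ := by
            ext x
            simp only [mem_preimage, mem_inter_iff, square, mem_prod, mem_empty_iff_false, iff_false]
            exact fun hx => hy hx.1.2
          rw [this, measure_empty]
    _ = ENNReal.ofReal (N * (b - a)) := by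
        rw [lintegral_indicator_const measurableSet_Icc, Real.volume_Icc, sub_zero, mul_comm,
          ENNReal.ofReal_mul hN]

lemma volume_horizontal_strip_le {N : ℝ} (hN : 0 ≤ N) {a b : ℝ} :
    volume (square N ∩ (fun p : Plane => p.2) ⁻¹' Ico a b) ≤ ENNReal.ofReal (N * (b - a)) := by
  have : square N ∩ (fun p : Plane => p.2) ⁻¹' Ico a b ⊆ Icc 0 N ×ˢ Ico a b :=
    fun p hp => ⟨hp.1.1, hp.2⟩
  refine (measure_mono this).trans (le_of_eq ?_)
  rw [Measure.volume_eq_prod, Measure.prod_prod, Real.volume_Icc, Real.volume_Ico, sub_zero,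
    ENNReal.ofReal_mul hN]

lemma IsMarkedPoissonProcess.ae_direction {Ω : Type*} [MeasurableSpace Ω] {P : Measure Ω}
    [IsProbabilityMeasure P] {lam : ℝ} {X D : ℕ → Ω → Plane}
    (h : IsMarkedPoissonProcess P lam X D) : ∀ᵐ ω ∂P, ∀ i, ∃ b, D i ω = axis b := by
  rw [ae_all_iff]
  intro i
  have hv : MeasurableSet {ω | D i ω = (0, 1)} := h.measurable_dir i (measurableSet_singleton _)
  have hh : MeasurableSet {ω | D i ω = (1, 0)} := h.measurable_dir i (measurableSet_singleton _)
  have hdisj : Disjoint {ω | D i ω = (0, 1)} {ω | D i ω = (1, 0)} := by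
    refine disjoint_left.2 fun ω h0 h1 => ?_
    have h2 : ((0, 1) : Plane) = (1, 0) := Eq.trans (Eq.symm h0) h1
    simp at h2
  have h1 : P ({ω | D i ω = (0, 1)} ∪ {ω | D i ω = (1, 0)}) = 1 := by
    rw [measure_union hdisj hh, h.vertical, h.horizontal, ENNReal.add_halves]
  filter_upwards [(mem_ae_iff_prob_eq_one (hv.union hh)).2 h1] with ω hω
  rcases hω with hω | hω
  · exact ⟨false, hω⟩
  · exact ⟨true, hω⟩

/-- Almost surely the seeds in the square are in general position. -/
theorem IsMarkedPoissonProcess.ae_isGeneric {Ω : Type*} [MeasurableSpace Ω] {P : Measure Ω}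
    [IsProbabilityMeasure P] {lam : ℝ} {X D : ℕ → Ω → Plane} (hlam : 0 ≤ lam)
    (h : IsMarkedPoissonProcess P lam X D) {N : ℝ} (hN : 0 ≤ N) :
    ∀ᵐ ω ∂P, IsGeneric N (seedsIn X D N ω) := by
  have hp := h.poisson
  -- On the square, `|x + α y| ≤ 2 * N` whenever `|α| ≤ 1`.
  obtain ⟨M, hM⟩ := exists_nat_gt (2 * N)
  have hshear : ∀ α : ℝ, |α| ≤ 1 → ∀ᵐ ω ∂P, ∀ i j, X i ω ∈ square N → X j ω ∈ square N →
      (X i ω).1 + α * (X i ω).2 = (X j ω).1 + α * (X j ω).2 → i = j := by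
    intro α hα
    refine hp.ae_injOn hlam (measurableSet_square N) (f := fun p => p.1 + α * p.2)
      (measurable_fst.add (measurable_snd.const_mul α)) (M := M) ?_ hN
      fun a b _ => volume_strip_le hN α
    rintro p ⟨⟨h1, h2⟩, h3, h4⟩
    obtain ⟨h5, h6⟩ := abs_le.1 hα
    constructor <;> nlinarith
  have hhor : ∀ᵐ ω ∂P, ∀ i j, X i ω ∈ square N → X j ω ∈ square N →
      (X i ω).2 = (X j ω).2 → i = j := by
    refine hp.ae_injOn hlam (measurableSet_square N) (f := fun p => p.2) measurable_snd (M := M)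
      ?_ hN fun a b _ => volume_horizontal_strip_le hN
    rintro p ⟨-, h3, h4⟩
    constructor <;> linarith
  -- The shear 0 separates first coordinates; the shears 1 and -1 exclude two points on a common
  -- diagonal of either slope.
  filter_upwards [hp.ae_finite (measurableSet_square N) (volume_square_ne_top N),
    hp.ae_notMem isClosed_frontier.measurableSet (volume_frontier_square N), h.ae_direction,
    hshear 0 (by simp), hshear 1 (by simp), hshear (-1) (by simp), hhor]
    with ω hfin hfront hdir h0 h1 h2 h3
  refine ⟨?_, ?_, ?_, ?_, ?_⟩
  · refine (hfin.image fun i => (X i ω, D i ω)).subset ?_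
    rintro _ ⟨i, hi, rfl⟩
    exact ⟨i, hi, rfl⟩
  · rintro _ ⟨i, -, rfl⟩
    exact hdir i
  · rintro _ ⟨i, hi, rfl⟩ b
    have : X i ω ∈ interior (square N) := by
      by_contra hc
      exact hfront i ⟨subset_closure hi, hc⟩
    rw [square, interior_prod_eq, interior_Icc] at this
    cases b
    · exact this.2
    · exact this.1
  · rintro _ ⟨i, hi, rfl⟩ _ ⟨j, hj, rfl⟩ b hb
    have : i = j := by
      cases b
      · exact h3 i j hi hj hb
      · exact h0 i j hi hj (by simpa [par] using hb)
    rw [this]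
  · rintro _ ⟨i, hi, rfl⟩ _ ⟨j, hj, rfl⟩ hne b hb
    apply hne
    have hb' : |(X i ω).1 - (X j ω).1| = |(X i ω).2 - (X j ω).2| := by
      cases b
      · exact hb.symm
      · exact hb
    have : i = j := by
      rcases abs_eq_abs.1 hb' with he | he
      · exact h2 i j hi hj (by linarith)
      · exact h1 i j hi hj (by linarith)
    rw [this]

lemma fst_image_seedsIn {Ω : Type*} (X D : ℕ → Ω → Plane) (N : ℝ) (ω : Ω) :
    Prod.fst '' seedsIn X D N ω = pointsIn X N ω := by
  ext u
  constructor
  · rintro ⟨_, ⟨i, hi, rfl⟩, rfl⟩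
    exact ⟨⟨i, rfl⟩, hi⟩
  · rintro ⟨⟨i, rfl⟩, hi⟩
    exact ⟨_, ⟨i, hi, rfl⟩, rfl⟩

end RectGilbert

theorem mainTheorem7 {Ω : Type*} [MeasurableSpace Ω] (P : Measure Ω) [IsProbabilityMeasure P]
    (lam : ℝ) (hlam : 0 < lam) (X D : ℕ → Ω → RectGilbert.Plane)
    (hXD : RectGilbert.IsMarkedPoissonProcess P lam X D) (N : ℝ) (hN : 2 < N) :
    ∀ᵐ ω ∂P,
      (RectGilbert.pointsIn X N ω).Finite ∧
      (∃! T : RectGilbert.rays (RectGilbert.seedsIn X D N ω) → ℝ≥0∞, RectGilbert.IsGrowth T) ∧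
      ∀ T : RectGilbert.rays (RectGilbert.seedsIn X D N ω) → ℝ≥0∞, RectGilbert.IsGrowth T →
        (RectGilbert.planarGraph N (RectGilbert.drawing T N)).edgeSet.encard =
          3 * (RectGilbert.pointsIn X N ω).encard + 4 := by
  have hN0 : 0 < N := by linarith
  filter_upwards [hXD.ae_isGeneric hlam.le hN0.le] with ω hω
  have himage := RectGilbert.fst_image_seedsIn X D N ω
  refine ⟨himage ▸ hω.finite.image _, hω.existsUnique_growth, fun T hT => ?_⟩
  -- Distinct seeds sit at distinct points, so counting seeds is counting points.
  have hinj : InjOn Prod.fst (RectGilbert.seedsIn X D N ω) := fun s hs s' hs' he =>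
    hω.inj s hs s' hs' true (by rw [he])
  rw [hω.encard_edgeSet hN0 hT, ← himage, hinj.encard_image]
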